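/- Let $\Omega=(a,b)\times(c,d)$, $0<T<\infty$, $\lambda\in\mathbb R\setminus\{0\}$, and let $u$ be a solution on $[0,T]$ of the logarithmic Schrödinger equation $$ i\,\partial_t u+\Delta u=\lambda u\ln(|u|^2)\ \text{ in }\Omega\times(0,T],\qquad u=0\ \text{ on }\partial\Omega,\qquad u(\cdot,0)=u_0\ \text{ on }\overline\Omega, $$ (with $0\ln 0=0$) such that $$ u\in C^2([0,T];L^\infty(\Omega))\cap C^1([0,T];W^{2,\infty}(\Omega))\cap C^0([0,T];W^{4,\infty}(\Omega)\cap H^1_0(\Omega)). $$ For positive integers $J,K,N$ put $h_x=(b-a)/J$, $h_y=(d-c)/K$, $h=\max\{h_x,h_y\}$, $h_{\min}=\min\{h_x,h_y\}$, $\tau=T/N$, $x_j=a+jh_x$, $y_k=c+kh_y$, $t_n=n\tau$, and $f(z)=z\ln|z|$, $f(0)=0$. Let $u^n=(u^n_{j,k})_{0\le j\le J,\,0\le k\le K}$, $0\le n\le N$, be the solution of the linearized BDF1 scheme $$ i\,\frac{u^{n+1}_{j,k}-u^n_{j,k}}{\tau}+\frac{u^{n+1}_{j+1,k}-2u^{n+1}_{j,k}+u^{n+1}_{j-1,k}}{h_x^2}+\frac{u^{n+1}_{j,k+1}-2u^{n+1}_{j,k}+u^{n+1}_{j,k-1}}{h_y^2}=2\lambda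 f(u^n_{j,k}) $$ for $1\le j\le J-1$, $1\le k\le K-1$, $0\le n\le N-1$, with $u^n_{j,k}=0$ whenever $j\in\{0,J\}$ or $k\in\{0,K\}$, and $u^0_{j,k}=u_0(x_j,y_k)$. Let $e^n_{j,k}=u(x_j,y_k,t_n)-u^n_{j,k}$, and for grid functions $v$ put $$ \|v\|^2=h_xh_y\sum_{j=1}^{J-1}\sum_{k=1}^{K-1}|v_{j,k}|^2,\qquad |v|_1^2=h_xh_y\sum_{j=0}^{J-1}\sum_{k=0}^{K-1}\Big(\Big|\frac{v_{j+1,k}-v_{j,k}}{h_x}\Big|^2+\Big|\frac{v_{j,k+1}-v_{j,k}}{h_y}\Big|^2\Big). $$ Then there is a constant $C_u>0$, depending only on (a bound for) the norms of $u$ in the three spaces $C^2([0,T];L^\infty(\Omega))$, $C^1([0,T];W^{2,\infty}(\Omega))$, $C^0([0,T];W^{4,\infty}(\Omega))$ and on $|\lambda|$, $|\Omega|$ and $T$, such that the following holds. For every $\kappa$ there are $h_0,\tau_0>0$ such that for all grids with $h\le\kappa h_{\min}$, $0<h\le h_0$ and $0<\tau\le\tau_0$ (no relation between $\tau$ and $h$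 is required), and for all $0\le n\le N$, $$ \|e^n\|\le C_u(\tau+h^2),\qquad |e^n|_1\le C_u\,\tau^{-1/2}(\tau+h^2). $$ -/

import Mathlib

open MeasureTheory Set
open scoped ENNReal ContDiff

noncomputable section

namespace LogSE

/-! ### Sobolev spaces `W^{k,∞}(Ω)` of complex functions on a planar domain -/

/-- The partial derivative `∂ₓ^p ∂_y^q φ` of a smooth function of two real variables. -/
def pderiv (p q : ℕ) (φ : ℝ × ℝ → ℝ) : ℝ × ℝ → ℝ :=
  (fun ψ : ℝ × ℝ → ℝ => fun z => fderiv ℝ ψ z (1, 0))^[p]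
    ((fun ψ : ℝ × ℝ → ℝ => fun z => fderiv ℝ ψ z (0, 1))^[q] φ)

/-- `φ ∈ C_c^∞(Ω)`. -/
def IsTestFunction (Ω : Set (ℝ × ℝ)) (φ : ℝ × ℝ → ℝ) : Prop :=
  ContDiff ℝ ∞ φ ∧ HasCompactSupport φ ∧ tsupport φ ⊆ Ω

/-- `w = ∂ₓ^p ∂_y^q g` in `Ω` in the weak sense. -/
def IsWeakDeriv (Ω : Set (ℝ × ℝ)) (p q : ℕ) (g w : ℝ × ℝ → ℂ) : Prop :=
  ∀ φ : ℝ × ℝ → ℝ, IsTestFunction Ω φ →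
    ∫ z in Ω, g z * (pderiv p q φ z : ℂ) = (-1) ^ (p + q) * ∫ z in Ω, w z * (φ z : ℂ)

/-- `L^∞(Ω; ℂ)` with the essential supremum norm. -/
abbrev LInf (Ω : Set (ℝ × ℝ)) : Type := Lp ℂ ∞ (volume.restrict Ω)

/-- The multi-indices `(p, q)` with `p + q ≤ k`. -/
abbrev MultiIdx (k : ℕ) : Type :=
  {α : Fin (k + 1) × Fin (k + 1) // (α.1 : ℕ) + (α.2 : ℕ) ≤ k}

/-- The multi-index `(0, 0)`. -/
def zeroIdx (k : ℕ) : MultiIdx k := ⟨(0, 0), by simp⟩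

theorem smooth_dir {ψ : ℝ × ℝ → ℝ} (h : ContDiff ℝ ∞ ψ) (hc : HasCompactSupport ψ) (v : ℝ × ℝ) :
    ContDiff ℝ ∞ (fun z => fderiv ℝ ψ z v) ∧ HasCompactSupport (fun z => fderiv ℝ ψ z v) :=
  ⟨(h.fderiv_right (m := ∞) (by simp)).clm_apply contDiff_const, hc.fderiv_apply ℝ v⟩

theorem smooth_iter {ψ : ℝ × ℝ → ℝ} (h : ContDiff ℝ ∞ ψ) (hc : HasCompactSupport ψ)
    (v : ℝ × ℝ) (n : ℕ) :
    ContDiff ℝ ∞ ((fun ψ : ℝ × ℝ → ℝ => fun z => fderiv ℝ ψ z v)^[n] ψ) ∧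
      HasCompactSupport ((fun ψ : ℝ × ℝ → ℝ => fun z => fderiv ℝ ψ z v)^[n] ψ) := by
  induction n with
  | zero => exact ⟨h, hc⟩
  | succ n ih =>
    rw [Function.iterate_succ_apply']
    exact smooth_dir ih.1 ih.2 v

theorem smooth_pderiv {ψ : ℝ × ℝ → ℝ} (h : ContDiff ℝ ∞ ψ) (hc : HasCompactSupport ψ) (p q : ℕ) :
    ContDiff ℝ ∞ (pderiv p q ψ) ∧ HasCompactSupport (pderiv p q ψ) :=
  smooth_iter (smooth_iter h hc _ q).1 (smooth_iter h hc _ q).2 _ p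

theorem integrable_mul_test {Ω : Set (ℝ × ℝ)} (g : LInf Ω) {φ : ℝ × ℝ → ℝ}
    (h : ContDiff ℝ ∞ φ) (hc : HasCompactSupport φ) :
    Integrable (fun z => g z * (φ z : ℂ)) (volume.restrict Ω) := by
  have h1 : Integrable (fun z => (φ z : ℂ)) (volume.restrict Ω) :=
    ((h.continuous.integrable_of_hasCompactSupport hc).restrict).ofReal
  exact h1.mul_of_top_right (Lp.memLp g)

/-- The Sobolev space `W^{k,∞}(Ω)`: an element is the family `(∂^α g)_{|α| ≤ k}` of the weak
derivatives of a function `g`, each of them in `L^∞(Ω)`. The norm which it inherits is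
`max_{|α| ≤ k} ‖∂^α g‖_{L^∞(Ω)}`. -/
def WInf (Ω : Set (ℝ × ℝ)) (k : ℕ) : Submodule ℝ (MultiIdx k → LInf Ω) where
  carrier := {g | ∀ α : MultiIdx k, IsWeakDeriv Ω α.1.1 α.1.2 (g (zeroIdx k)) (g α)}
  zero_mem' := by
    intro α φ hφ
    have h0 : ((0 : LInf Ω) : ℝ × ℝ → ℂ) =ᵐ[volume.restrict Ω] 0 := Lp.coeFn_zero _ _ _
    have e (ψ : ℝ × ℝ → ℝ) : ∫ z in Ω, (0 : LInf Ω) z * (ψ z : ℂ) = 0 := by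
      refine integral_eq_zero_of_ae ?_
      filter_upwards [h0] with z hz
      rw [hz]
      simp
    simp only [Pi.zero_apply, e, mul_zero]
  add_mem' := by
    intro f g hf hg α φ hφ
    have e (u v : LInf Ω) (ψ : ℝ × ℝ → ℝ) (h : ContDiff ℝ ∞ ψ) (hc : HasCompactSupport ψ) :
        ∫ z in Ω, (u + v : LInf Ω) z * (ψ z : ℂ) =
          (∫ z in Ω, u z * (ψ z : ℂ)) + ∫ z in Ω, v z * (ψ z : ℂ) := by
      rw [← integral_add (integrable_mul_test u h hc) (integrable_mul_test v h hc)]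
      refine integral_congr_ae ?_
      filter_upwards [Lp.coeFn_add u v] with z hz
      rw [hz, Pi.add_apply, add_mul]
    have hp := smooth_pderiv hφ.1 hφ.2.1 α.1.1 α.1.2
    simp only [Pi.add_apply]
    rw [e _ _ _ hp.1 hp.2, e _ _ _ hφ.1 hφ.2.1, hf α φ hφ, hg α φ hφ, mul_add]
  smul_mem' := by
    intro c f hf α φ hφ
    have e (u : LInf Ω) (ψ : ℝ × ℝ → ℝ) :
        ∫ z in Ω, (c • u : LInf Ω) z * (ψ z : ℂ) = (c : ℂ) * ∫ z in Ω, u z * (ψ z : ℂ) := by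
      rw [← integral_const_mul]
      refine integral_congr_ae ?_
      filter_upwards [Lp.coeFn_smul c u] with z hz
      rw [hz, Pi.smul_apply, Complex.real_smul, mul_assoc]
    simp only [Pi.smul_apply]
    rw [e, e, hf α φ hφ]
    ring

/-- The weak derivative `∂ₓ^p ∂_y^q g` of an element `g` of `W^{k,∞}(Ω)`, where `p + q ≤ k`. -/
def weakD {Ω : Set (ℝ × ℝ)} {k : ℕ} (g : WInf Ω k) (p q : ℕ) (h : p + q ≤ k) : LInf Ω :=
  g.1 ⟨(⟨p, by omega⟩, ⟨q, by omega⟩), h⟩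

/-- `V : [0,T] → W^{k,∞}(Ω)` is the map `t ↦ u(·,t)`. -/
def Represents {Ω : Set (ℝ × ℝ)} {k : ℕ} (T : ℝ) (V : ℝ → WInf Ω k) (u : ℝ → ℝ × ℝ → ℂ) : Prop :=
  ∀ t ∈ Icc 0 T, (weakD (V t) 0 0 (Nat.zero_le k) : ℝ × ℝ → ℂ) =ᵐ[volume.restrict Ω] u t

/-- `u ∈ C^m([0,T]; W^{k,∞}(Ω))`, with `‖∂ₜ^j u(·,t)‖_{W^{k,∞}} ≤ M` for all `j ≤ m` and
`t ∈ [0,T]`. Note that `W^{0,∞} = L^∞`. -/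
def InCWWithBound (Ω : Set (ℝ × ℝ)) (T : ℝ) (m k : ℕ) (M : ℝ) (u : ℝ → ℝ × ℝ → ℂ) : Prop :=
  ∃ V : ℝ → WInf Ω k, Represents T V u ∧ ContDiffOn ℝ m V (Icc 0 T) ∧
    ∀ j ≤ m, ∀ t ∈ Icc 0 T, ‖iteratedDerivWithin j V (Icc 0 T) t‖ ≤ M

/-! ### The logarithmic Schrödinger equation on a rectangle -/

/-- The open rectangle `(a,b) × (c,d)`. -/
def rect (a b c d : ℝ) : Set (ℝ × ℝ) := Ioo a b ×ˢ Ioo c d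

/-- `u` (with `u t (x, y)` for `u(x,y,t)`) solves on `[0,T]` the problem
`i ∂ₜu + Δu = λ u ln(|u|²)` in `Ω × (0,T]`, `u = 0` on `∂Ω`, `u(·,0) = u₀` on the closure of `Ω`.
It belongs to `C¹([0,T]; L^∞(Ω)) ∩ C⁰([0,T]; W^{2,∞}(Ω))`, so that both sides of the equation are
in `L^∞(Ω)` at every time, where they have to agree; `u(·,t)` is the continuous representative.
Recall `Real.log 0 = 0`. -/
structure IsSolution (Ω : Set (ℝ × ℝ)) (T lam : ℝ) (u₀ : ℝ × ℝ → ℂ) (u : ℝ → ℝ × ℝ → ℂ) :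
    Prop where
  continuousOn : ∀ t ∈ Icc 0 T, ContinuousOn (u t) (closure Ω)
  equation : ∃ (P : ℝ → WInf Ω 0) (Q : ℝ → WInf Ω 2),
    Represents T P u ∧ ContDiffOn ℝ 1 P (Icc 0 T) ∧
    Represents T Q u ∧ ContDiffOn ℝ 0 Q (Icc 0 T) ∧
    ∀ t ∈ Ioc 0 T, ∀ᵐ z ∂(volume.restrict Ω),
      Complex.I * weakD (derivWithin P (Icc 0 T) t) 0 0 le_rfl z +
        (weakD (Q t) 2 0 le_rfl z + weakD (Q t) 0 2 le_rfl z) =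
      (lam : ℂ) * u t z * (Real.log (‖u t z‖ ^ 2) : ℂ)
  boundary : ∀ t ∈ Icc 0 T, ∀ z ∈ frontier Ω, u t z = 0
  initial : ∀ z ∈ closure Ω, u 0 z = u₀ z

/-! ### The finite difference scheme

A grid function `v` on `{0,…,J} × {0,…,K}` is given by its values `v j k`; its values at other
indices play no role. -/

/-- `f(z) = z ln|z|`, with `f(0) = 0`. -/
def f (z : ℂ) : ℂ := z * (Real.log ‖z‖ : ℂ)

/-- Membership in `X_h⁰`: `v` vanishes at the boundary indices of the grid. -/
def VanishesOnBoundary (J K : ℕ) (v : ℕ → ℕ → ℂ) : Prop :=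
  ∀ j ≤ J, ∀ k ≤ K, (j = 0 ∨ j = J ∨ k = 0 ∨ k = K) → v j k = 0

/-- The forward difference `δₓ⁺`. -/
def deltaX (hx : ℝ) (v : ℕ → ℕ → ℂ) (j k : ℕ) : ℂ := (v (j + 1) k - v j k) / hx

/-- The forward difference `δ_y⁺`. -/
def deltaY (hy : ℝ) (v : ℕ → ℕ → ℂ) (j k : ℕ) : ℂ := (v j (k + 1) - v j k) / hy

/-- The five-point Laplacian `δ²_∇ = δₓ² + δ_y²`, used at interior indices only
(where `1 ≤ j` and `1 ≤ k`). -/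
def discreteLaplacian (hx hy : ℝ) (v : ℕ → ℕ → ℂ) (j k : ℕ) : ℂ :=
  (v (j + 1) k - 2 * v j k + v (j - 1) k) / (hx : ℂ) ^ 2 +
    (v j (k + 1) - 2 * v j k + v j (k - 1)) / (hy : ℂ) ^ 2

/-- The discrete `L²` norm. -/
def normL2 (hx hy : ℝ) (J K : ℕ) (v : ℕ → ℕ → ℂ) : ℝ :=
  Real.sqrt (hx * hy * ∑ j ∈ Finset.Ioo 0 J, ∑ k ∈ Finset.Ioo 0 K, ‖v j k‖ ^ 2)

/-- The discrete `H¹` seminorm. -/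
def seminormH1 (hx hy : ℝ) (J K : ℕ) (v : ℕ → ℕ → ℂ) : ℝ :=
  Real.sqrt (hx * hy * ∑ j ∈ Finset.range J, ∑ k ∈ Finset.range K, ‖deltaX hx v j k‖ ^ 2 +
    hx * hy * ∑ j ∈ Finset.range J, ∑ k ∈ Finset.range K, ‖deltaY hy v j k‖ ^ 2)

/-- The restriction of a function to the grid points `(a + j hx, c + k hy)`. -/
def gridRestrict (a c hx hy : ℝ) (g : ℝ × ℝ → ℂ) (j k : ℕ) : ℂ := g (a + j * hx, c + k * hy)

/-- `U n j k = u^n_{j,k}`, `n = 0,…,N`, is the solution of the linearized BDF1 scheme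
`i δₜ⁻ u^{n+1} + δ²_∇ u^{n+1} = 2λ f(u^n)` at the interior grid points, `n = 0,…,N-1`, with
`u^n ∈ X_h⁰` and initial value the restriction of `u₀` to the grid. -/
structure IsBDF1 (a c hx hy τ : ℝ) (J K N : ℕ) (lam : ℝ) (u₀ : ℝ × ℝ → ℂ)
    (U : ℕ → ℕ → ℕ → ℂ) : Prop where
  boundary : ∀ n ≤ N, VanishesOnBoundary J K (U n)
  initial : ∀ j ≤ J, ∀ k ≤ K, U 0 j k = gridRestrict a c hx hy u₀ j k
  step : ∀ n < N, ∀ j ∈ Finset.Ioo 0 J, ∀ k ∈ Finset.Ioo 0 K,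
    Complex.I * ((U (n + 1) j k - U n j k) / τ) + discreteLaplacian hx hy (U (n + 1)) j k =
      2 * (lam : ℂ) * f (U n j k)

/-- The error grid function `e^n_{j,k} = u(x_j, y_k, t_n) - u^n_{j,k}`, `t_n = n τ`. -/
def err (a c hx hy τ : ℝ) (u : ℝ → ℝ × ℝ → ℂ) (U : ℕ → ℕ → ℕ → ℂ) (n : ℕ) : ℕ → ℕ → ℂ :=
  fun j k => gridRestrict a c hx hy (u (n * τ)) j k - U n j k

end LogSE

end

noncomputable section

namespace LogSE

/-! ### The logarithmic nonlinearity -/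

/-! The error solves the same linear scheme, with forcing `2 * lam * F + R`: `F` is the difference
of `f` at the exact and the discrete solution at the old time level, and `R` is the truncation
error. Put `δ = τ + h ^ 2`. Two obstacles arise. First, `f` is not Lipschitz, since its logarithm
blows up at 0. Second, the implicit scheme has to be tested with the new error `w`, while `F` is
controlled only against the old error `v`.

Taking the imaginary part of the tested scheme removes the Laplacian and leaves the term `‖w - v‖ ^
2` with a good sign. Split `w = v + (w - v)`. The pairing of `F` with `v` is harmless by the
Cazenave–Haraux inequality `abs_im_f_sub_mul_conj_le`. The pairing with `w - v` is absorbed by the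
good term at the price of `τ ^ 2 * ‖F‖ ^ 2` (`pointwise_energy_le`). One power of `τ` compensates
for the logarithm: `norm_f_sub_sq_le` bounds `‖F‖ ^ 2` by a combination of the first, second and
fourth powers of the error, and `τ * ‖v‖` is at most `(τ ^ 2 + ‖v‖ ^ 2) / 2`. This costs only `τ ^ 2
≤ δ ^ 2`.

The quartic term would need a maximum bound on the discrete solution. Instead, the discrete
Ladyzhenskaya inequality `sum_norm_pow_four_le` bounds it by the product of the squared L² norm and
the squared H¹ seminorm, so it suffices that `τ` times the latter is at most 1/2. The real part of
the tested scheme supplies this bound, of size `δ ^ 2`, at the next time level (`gradient_step`).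
The induction in `stability` therefore closes for small `δ` with no relation between `τ` and `h`,
and the same bound gives the factor `τ ^ (-1/2)` in the H¹ estimate.

Consistency has to be proved for a solution with only weak derivatives in L^∞. The residual is a
continuous combination of translates of `u`, so by `norm_le_of_forall_test` its size is tested
against nonnegative bump functions. There translations and derivatives fall on the test function,
and Taylor's formula is applied to scalar functions of the shift (`truncation_error_le`). -/

theorem norm_mul_abs_log_sub_log_le {z w : ℂ} (hz : z ≠ 0) (h : ‖z‖ ≤ ‖w‖) :
    ‖z‖ * |Real.log ‖z‖ - Real.log ‖w‖| ≤ ‖z - w‖ := by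
  have hz0 : 0 < ‖z‖ := norm_pos_iff.2 hz
  have hw0 : 0 < ‖w‖ := hz0.trans_le h
  have hl : Real.log ‖z‖ ≤ Real.log ‖w‖ := Real.log_le_log hz0 h
  have h1 : Real.log (‖w‖ / ‖z‖) ≤ ‖w‖ / ‖z‖ - 1 := Real.log_le_sub_one_of_pos (by positivity)
  rw [Real.log_div hw0.ne' hz0.ne'] at h1
  rw [abs_sub_comm, abs_of_nonneg (sub_nonneg.2 hl)]
  calc ‖z‖ * (Real.log ‖w‖ - Real.log ‖z‖) ≤ ‖z‖ * (‖w‖ / ‖z‖ - 1) := by gcongr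
    _ = ‖w‖ - ‖z‖ := by field_simp
    _ ≤ ‖w - z‖ := norm_sub_norm_le w z
    _ = ‖z - w‖ := norm_sub_rev w z

theorem norm_f_sub_le_of_le {z w : ℂ} (h : ‖z‖ ≤ ‖w‖) :
    ‖f z - f w‖ ≤ ‖z - w‖ * (1 + |Real.log ‖w‖|) := by
  have e : f z - f w = (z - w) * (Real.log ‖w‖ : ℂ) +
      z * ((Real.log ‖z‖ - Real.log ‖w‖ : ℝ) : ℂ) := by
    simp only [f]; push_cast; ring
  have h2 : ‖z * ((Real.log ‖z‖ - Real.log ‖w‖ : ℝ) : ℂ)‖ ≤ ‖z - w‖ := by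
    rw [norm_mul, Complex.norm_real, Real.norm_eq_abs]
    rcases eq_or_ne z 0 with rfl | hz
    · simp
    · exact norm_mul_abs_log_sub_log_le hz h
  calc ‖f z - f w‖ ≤ ‖(z - w) * (Real.log ‖w‖ : ℂ)‖ + ‖z - w‖ := by
        rw [e]; exact (norm_add_le _ _).trans (by gcongr)
    _ = ‖z - w‖ * (1 + |Real.log ‖w‖|) := by
        rw [norm_mul, Complex.norm_real, Real.norm_eq_abs]; ring

/-- The logarithm is taken at the larger modulus, so it is singular only when both points are near
0, and then `‖z - w‖` is small as well. -/
theorem norm_f_sub_le (z w : ℂ) :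
    ‖f z - f w‖ ≤ ‖z - w‖ * (1 + |Real.log (max ‖z‖ ‖w‖)|) := by
  rcases le_total ‖z‖ ‖w‖ with h | h
  · rw [max_eq_right h]; exact norm_f_sub_le_of_le h
  · rw [max_eq_left h, norm_sub_rev, norm_sub_rev z]; exact norm_f_sub_le_of_le h

/-- A Hölder estimate for `f` around a bounded point. -/
theorem norm_f_sub_sq_le {M : ℝ} {z w : ℂ} (hz : ‖z‖ ≤ M) :
    ‖f z - f w‖ ^ 2 ≤
      16 * ‖z - w‖ + (2 + 2 * (1 + M) ^ 2) * ‖z - w‖ ^ 2 + 2 * ‖z - w‖ ^ 4 := by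
  have hM : 0 ≤ M := (norm_nonneg z).trans hz
  have h0 := norm_f_sub_le z w
  set e := ‖z - w‖ with he
  have he0 : 0 ≤ e := norm_nonneg _
  set m := max ‖z‖ ‖w‖ with hm
  rcases he0.eq_or_lt with h | hpos
  · rw [← h, zero_mul] at h0
    have : ‖f z - f w‖ = 0 := le_antisymm h0 (norm_nonneg _)
    rw [this, ← h]; norm_num
  have hem : e ≤ 2 * m := by
    have := norm_sub_le z w
    have h1 := le_max_left ‖z‖ ‖w‖
    have h2 := le_max_right ‖z‖ ‖w‖
    linarith
  have hm0 : 0 < m := by linarith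
  have hmM : m ≤ M + e := by
    refine max_le (by linarith) ?_
    have := norm_sub_norm_le w z
    rw [norm_sub_rev] at this
    linarith
  -- For `m ≥ 1` the logarithm is at most `m ≤ M + e`, which produces the quartic term. For `m ≤ 1`
  -- the bound `e ≤ 2 * m` turns `|log m|` into `log (2 / e)`, which is at most `2 * √(2 / e)`;
  -- squaring then costs one power of `e` and leaves the linear term `16 * e`.
  rcases le_total 1 m with h1 | h1
  · have hl : |Real.log m| ≤ M + e := by
      rw [abs_of_nonneg (Real.log_nonneg h1)]
      linarith [Real.log_le_self hm0.le]
    have h3 : ‖f z - f w‖ ≤ e * (1 + M + e) := h0.trans (mul_le_mul_of_nonneg_left (by linarith) he0)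
    calc ‖f z - f w‖ ^ 2 ≤ (e * (1 + M + e)) ^ 2 := by gcongr
      _ ≤ 2 * (1 + M) ^ 2 * e ^ 2 + 2 * e ^ 4 := by
        nlinarith [mul_nonneg (sq_nonneg e) (sq_nonneg (1 + M - e))]
      _ ≤ _ := by nlinarith [sq_nonneg e]
  · have hs : 0 < √(2 / e) := Real.sqrt_pos.2 (by positivity)
    have hl : |Real.log m| ≤ 2 * √(2 / e) := by
      rw [abs_of_nonpos (Real.log_nonpos hm0.le h1), ← Real.log_inv]
      have h4 : m⁻¹ ≤ 2 / e := by
        rw [inv_eq_one_div, div_le_div_iff₀ hm0 hpos]; linarith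
      calc Real.log m⁻¹ ≤ Real.log (2 / e) := Real.log_le_log (by positivity) h4
        _ = 2 * Real.log √(2 / e) := by
          rw [Real.log_sqrt (by positivity)]; ring
        _ ≤ 2 * √(2 / e) := by gcongr; exact Real.log_le_self hs.le
    have h3 : ‖f z - f w‖ ≤ e * (1 + 2 * √(2 / e)) := h0.trans (by gcongr)
    have hsq : √(2 / e) ^ 2 = 2 / e := Real.sq_sqrt (by positivity)
    calc ‖f z - f w‖ ^ 2 ≤ (e * (1 + 2 * √(2 / e))) ^ 2 := by gcongr
      _ ≤ e ^ 2 * (2 + 8 * √(2 / e) ^ 2) := by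
        rw [mul_pow]; gcongr; nlinarith [sq_nonneg (1 - 2 * √(2 / e))]
      _ = 16 * e + 2 * e ^ 2 := by rw [hsq]; field_simp; ring
      _ ≤ _ := by nlinarith [mul_nonneg (sq_nonneg (1 + M)) (sq_nonneg e), pow_nonneg he0 4]

theorem continuous_f : Continuous f := by
  refine continuous_iff_continuousAt.2 fun z => ?_
  have h : Filter.Tendsto (fun w : ℂ => 16 * ‖z - w‖ + (2 + 2 * (1 + ‖z‖) ^ 2) * ‖z - w‖ ^ 2 +
      2 * ‖z - w‖ ^ 4) (nhds z) (nhds 0) := by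
    have : Continuous (fun w : ℂ => 16 * ‖z - w‖ + (2 + 2 * (1 + ‖z‖) ^ 2) * ‖z - w‖ ^ 2 +
      2 * ‖z - w‖ ^ 4) := by fun_prop
    simpa using this.tendsto z
  have h2 := squeeze_zero (fun w => sq_nonneg ‖f z - f w‖)
    (fun w => norm_f_sub_sq_le (w := w) le_rfl) h
  have h3 : Filter.Tendsto (fun w => √(‖f z - f w‖ ^ 2)) (nhds z) (nhds 0) := by
    simpa using h2.sqrt
  refine tendsto_iff_norm_sub_tendsto_zero.2 ?_
  refine h3.congr fun w => ?_
  rw [Real.sqrt_sq (norm_nonneg _), norm_sub_rev]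

/-- The inequality of Cazenave and Haraux. -/
theorem abs_im_f_sub_mul_conj_le (z w : ℂ) :
    |((f z - f w) * (starRingEnd ℂ) (z - w)).im| ≤ ‖z - w‖ ^ 2 := by
  wlog h : ‖z‖ ≤ ‖w‖ generalizing z w
  · have e : (f z - f w) * (starRingEnd ℂ) (z - w) = (f w - f z) * (starRingEnd ℂ) (w - z) := by
      simp only [map_sub]; ring
    rw [e, norm_sub_rev]
    exact this w z (le_of_not_ge h)
  -- Write `f z - f w` as `(z - w) * log ‖w‖ + z * (log ‖z‖ - log ‖w‖)`. The first part times the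
  -- conjugate of `z - w` is real, so the unbounded factor `log ‖w‖` disappears.
  have e : ((f z - f w) * (starRingEnd ℂ) (z - w)).im =
      (z * (starRingEnd ℂ) (z - w)).im * (Real.log ‖z‖ - Real.log ‖w‖) := by
    simp only [f, Complex.mul_im, Complex.mul_re, Complex.sub_re, Complex.sub_im, Complex.conj_re,
      Complex.conj_im, Complex.ofReal_re, Complex.ofReal_im]
    ring
  rw [e, abs_mul]
  rcases eq_or_ne z 0 with rfl | hz
  · simp
  have h1 : |(z * (starRingEnd ℂ) (z - w)).im| ≤ ‖z‖ * ‖z - w‖ :=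
    (Complex.abs_im_le_norm _).trans (by rw [norm_mul, Complex.norm_conj])
  calc _ ≤ ‖z‖ * ‖z - w‖ * |Real.log ‖z‖ - Real.log ‖w‖| := by gcongr
    _ = ‖z - w‖ * (‖z‖ * |Real.log ‖z‖ - Real.log ‖w‖|) := by ring
    _ ≤ ‖z - w‖ * ‖z - w‖ := by gcongr; exact norm_mul_abs_log_sub_log_le hz h
    _ = _ := by ring

/-! ### Discrete calculus -/

theorem sum_Ioo_zero_succ {A : Type*} [AddCommMonoid A] (g : ℕ → A) (m : ℕ) :
    ∑ j ∈ Finset.Ioo 0 (m + 1), g j = ∑ j ∈ Finset.range m, g (j + 1) := by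
  refine Finset.sum_nbij' (fun j => j - 1) (fun j => j + 1) ?_ ?_ ?_ ?_ ?_ <;>
    intro j hj <;> simp only [Finset.mem_Ioo, Finset.mem_range] at * <;> first | omega | skip
  congr 1; omega

theorem sum_range_eq_sum_Ioo {A : Type*} [AddCommMonoid A] (g : ℕ → A) {J : ℕ} (hJ : 0 < J)
    (h0 : g 0 = 0) : ∑ j ∈ Finset.range J, g j = ∑ j ∈ Finset.Ioo 0 J, g j := by
  obtain ⟨m, rfl⟩ := Nat.exists_eq_add_of_lt hJ
  rw [zero_add, Finset.sum_range_succ', h0, add_zero, sum_Ioo_zero_succ]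

theorem sum_range_succ_eq_sum_Ioo {A : Type*} [AddCommMonoid A] (g : ℕ → A) {J : ℕ} (hJ : 0 < J)
    (h1 : g J = 0) : ∑ j ∈ Finset.range J, g (j + 1) = ∑ j ∈ Finset.Ioo 0 J, g j := by
  obtain ⟨m, rfl⟩ := Nat.exists_eq_add_of_lt hJ
  rw [zero_add] at *
  rw [Finset.sum_range_succ, h1, add_zero, sum_Ioo_zero_succ]

theorem sum_secondDiff_mul_conj {v : ℕ → ℂ} {J : ℕ} (hJ : 0 < J) (h0 : v 0 = 0) (h1 : v J = 0) :
    ∑ j ∈ Finset.Ioo 0 J, (v (j + 1) - 2 * v j + v (j - 1)) * (starRingEnd ℂ) (v j) =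
      -((∑ j ∈ Finset.range J, ‖v (j + 1) - v j‖ ^ 2 : ℝ) : ℂ) := by
  -- Summation by parts using only the left boundary value; the right one then removes the remaining
  -- boundary term.
  have key (m : ℕ) :
      ∑ j ∈ Finset.range m, (v (j + 2) - 2 * v (j + 1) + v j) * (starRingEnd ℂ) (v (j + 1)) =
        (v (m + 1) - v m) * (starRingEnd ℂ) (v m) -
          ((∑ j ∈ Finset.range m, ‖v (j + 1) - v j‖ ^ 2 : ℝ) : ℂ) := by
    induction m with
    | zero => simp [h0]
    | succ m ih =>
      rw [Finset.sum_range_succ, ih, Finset.sum_range_succ]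
      push_cast
      rw [← Complex.mul_conj']
      simp only [map_sub]
      ring
  obtain ⟨m, rfl⟩ := Nat.exists_eq_add_of_lt hJ
  rw [zero_add] at *
  rw [sum_Ioo_zero_succ, Finset.sum_range_succ]
  have := key m
  simp only [Nat.add_sub_cancel] at *
  rw [this, h1]
  push_cast
  rw [← Complex.mul_conj']
  simp only [map_sub, map_zero]
  ring

/-- The square of the discrete `L²` norm. -/
def sqL2 (hx hy : ℝ) (J K : ℕ) (v : ℕ → ℕ → ℂ) : ℝ :=
  hx * hy * ∑ j ∈ Finset.Ioo 0 J, ∑ k ∈ Finset.Ioo 0 K, ‖v j k‖ ^ 2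

/-- The square of the discrete `H¹` seminorm. -/
def sqH1 (hx hy : ℝ) (J K : ℕ) (v : ℕ → ℕ → ℂ) : ℝ :=
  hx * hy * ∑ j ∈ Finset.range J, ∑ k ∈ Finset.range K, ‖deltaX hx v j k‖ ^ 2 +
    hx * hy * ∑ j ∈ Finset.range J, ∑ k ∈ Finset.range K, ‖deltaY hy v j k‖ ^ 2

section Grid

variable {hx hy : ℝ} {J K : ℕ}

theorem sqL2_nonneg (hhx : 0 < hx) (hhy : 0 < hy) (v : ℕ → ℕ → ℂ) : 0 ≤ sqL2 hx hy J K v := by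
  unfold sqL2; positivity

theorem sum_deltaX_sq (hhx : 0 < hx) (hK : 0 < K) {v : ℕ → ℕ → ℂ}
    (hv : VanishesOnBoundary J K v) :
    hx ^ 2 * ∑ j ∈ Finset.range J, ∑ k ∈ Finset.range K, ‖deltaX hx v j k‖ ^ 2 =
      ∑ k ∈ Finset.Ioo 0 K, ∑ j ∈ Finset.range J, ‖v (j + 1) k - v j k‖ ^ 2 := by
  rw [Finset.sum_comm, ← sum_range_eq_sum_Ioo _ hK, Finset.mul_sum]
  · refine Finset.sum_congr rfl fun k _ => ?_
    rw [Finset.mul_sum]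
    refine Finset.sum_congr rfl fun j _ => ?_
    rw [deltaX, norm_div, Complex.norm_real, Real.norm_of_nonneg hhx.le, div_pow]
    field_simp
  · refine Finset.sum_eq_zero fun j hj => ?_
    have := Finset.mem_range.1 hj
    rw [hv (j + 1) (by omega) 0 (by omega) (by simp), hv j (by omega) 0 (by omega) (by simp)]
    simp

theorem sum_deltaY_sq (hhy : 0 < hy) (hJ : 0 < J) {v : ℕ → ℕ → ℂ}
    (hv : VanishesOnBoundary J K v) :
    hy ^ 2 * ∑ j ∈ Finset.range J, ∑ k ∈ Finset.range K, ‖deltaY hy v j k‖ ^ 2 =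
      ∑ j ∈ Finset.Ioo 0 J, ∑ k ∈ Finset.range K, ‖v j (k + 1) - v j k‖ ^ 2 := by
  have hv' : VanishesOnBoundary K J (fun k j => v j k) :=
    fun k hk j hj h => hv j hj k hk (by tauto)
  rw [← sum_deltaX_sq hhy hJ hv', Finset.sum_comm]
  rfl

theorem sum_discreteLaplacian_mul_conj (hhx : 0 < hx) (hhy : 0 < hy) (hJ : 0 < J) (hK : 0 < K)
    {v : ℕ → ℕ → ℂ} (hv : VanishesOnBoundary J K v) :
    (hx * hy : ℂ) * ∑ j ∈ Finset.Ioo 0 J, ∑ k ∈ Finset.Ioo 0 K,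
      discreteLaplacian hx hy v j k * (starRingEnd ℂ) (v j k) = -(sqH1 hx hy J K v : ℂ) := by
  have hx' : (hx : ℂ) ≠ 0 := by exact_mod_cast hhx.ne'
  have hy' : (hy : ℂ) ≠ 0 := by exact_mod_cast hhy.ne'
  have e1 : ∑ j ∈ Finset.Ioo 0 J, ∑ k ∈ Finset.Ioo 0 K,
      (v (j + 1) k - 2 * v j k + v (j - 1) k) * (starRingEnd ℂ) (v j k) =
      -((hx ^ 2 * ∑ j ∈ Finset.range J, ∑ k ∈ Finset.range K, ‖deltaX hx v j k‖ ^ 2 : ℝ) : ℂ) := by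
    rw [sum_deltaX_sq hhx hK hv, Finset.sum_comm, Complex.ofReal_sum, ← Finset.sum_neg_distrib]
    refine Finset.sum_congr rfl fun k hk => ?_
    have := Finset.mem_Ioo.1 hk
    exact sum_secondDiff_mul_conj (v := fun j => v j k) hJ (hv 0 (by omega) k (by omega) (by simp))
      (hv J le_rfl k (by omega) (by simp))
  have e2 : ∑ j ∈ Finset.Ioo 0 J, ∑ k ∈ Finset.Ioo 0 K,
      (v j (k + 1) - 2 * v j k + v j (k - 1)) * (starRingEnd ℂ) (v j k) =
      -((hy ^ 2 * ∑ j ∈ Finset.range J, ∑ k ∈ Finset.range K, ‖deltaY hy v j k‖ ^ 2 : ℝ) : ℂ) := by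
    rw [sum_deltaY_sq hhy hJ hv, Complex.ofReal_sum, ← Finset.sum_neg_distrib]
    refine Finset.sum_congr rfl fun j hj => ?_
    have := Finset.mem_Ioo.1 hj
    exact sum_secondDiff_mul_conj (v := fun k => v j k) hK (hv j (by omega) 0 (by omega) (by simp))
      (hv j (by omega) K le_rfl (by simp))
  have e3 : ∑ j ∈ Finset.Ioo 0 J, ∑ k ∈ Finset.Ioo 0 K,
      discreteLaplacian hx hy v j k * (starRingEnd ℂ) (v j k) =
      (∑ j ∈ Finset.Ioo 0 J, ∑ k ∈ Finset.Ioo 0 K,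
      (v (j + 1) k - 2 * v j k + v (j - 1) k) * (starRingEnd ℂ) (v j k)) / (hx : ℂ) ^ 2 +
      (∑ j ∈ Finset.Ioo 0 J, ∑ k ∈ Finset.Ioo 0 K,
      (v j (k + 1) - 2 * v j k + v j (k - 1)) * (starRingEnd ℂ) (v j k)) / (hy : ℂ) ^ 2 := by
    simp only [Finset.sum_div, ← Finset.sum_add_distrib, discreteLaplacian]
    refine Finset.sum_congr rfl fun j _ => Finset.sum_congr rfl fun k _ => ?_
    ring
  rw [e3, e1, e2, sqH1]
  push_cast
  field_simp
  ring

/-- Telescoping of `‖v i‖ ^ 2` from the zero boundary value. The bound does not depend on `j`, which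
is what lets the double sum factor in the Ladyzhenskaya inequality. -/
theorem norm_sq_le_sum_diff {v : ℕ → ℂ} (h0 : v 0 = 0) {j J : ℕ} (hj : j ≤ J) :
    ‖v j‖ ^ 2 ≤ ∑ i ∈ Finset.range J, ‖v (i + 1) - v i‖ * (‖v (i + 1)‖ + ‖v i‖) := by
  have h1 : ‖v j‖ ^ 2 ≤ ∑ i ∈ Finset.range j, ‖v (i + 1) - v i‖ * (‖v (i + 1)‖ + ‖v i‖) := by
    clear hj
    induction j with
    | zero => simp [h0]
    | succ j ih =>
      rw [Finset.sum_range_succ]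
      have := norm_sub_norm_le (v (j + 1)) (v j)
      nlinarith [norm_nonneg (v (j + 1)), norm_nonneg (v j)]
  exact h1.trans (Finset.sum_le_sum_of_subset_of_nonneg (Finset.range_mono hj)
    fun _ _ _ => by positivity)

theorem sq_sum_diff_le {v : ℕ → ℂ} {J : ℕ} (hJ : 0 < J) (h0 : v 0 = 0) (h1 : v J = 0) :
    (∑ i ∈ Finset.range J, ‖v (i + 1) - v i‖ * (‖v (i + 1)‖ + ‖v i‖)) ^ 2 ≤
      (4 * ∑ j ∈ Finset.Ioo 0 J, ‖v j‖ ^ 2) * ∑ i ∈ Finset.range J, ‖v (i + 1) - v i‖ ^ 2 := by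
  have e : 4 * ∑ j ∈ Finset.Ioo 0 J, ‖v j‖ ^ 2 =
      ∑ i ∈ Finset.range J, 2 * (‖v (i + 1)‖ ^ 2 + ‖v i‖ ^ 2) := by
    rw [← Finset.mul_sum, Finset.sum_add_distrib,
      sum_range_succ_eq_sum_Ioo (fun i => ‖v i‖ ^ 2) hJ (by simp [h1]),
      sum_range_eq_sum_Ioo (fun i => ‖v i‖ ^ 2) hJ (by simp [h0])]
    ring
  rw [e]
  refine Finset.sum_sq_le_sum_mul_sum_of_sq_le_mul _ (fun _ _ => by positivity)
    (fun _ _ => by positivity) fun i _ => ?_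
  rw [mul_pow, mul_comm]
  gcongr
  nlinarith [sq_nonneg (‖v (i + 1)‖ - ‖v i‖)]

/-- The discrete Ladyzhenskaya inequality. -/
theorem sum_norm_pow_four_le (hhx : 0 < hx) (hhy : 0 < hy) (hJ : 0 < J) (hK : 0 < K)
    {v : ℕ → ℕ → ℂ} (hv : VanishesOnBoundary J K v) :
    hx * hy * ∑ j ∈ Finset.Ioo 0 J, ∑ k ∈ Finset.Ioo 0 K, ‖v j k‖ ^ 4 ≤
      2 * sqL2 hx hy J K v * sqH1 hx hy J K v := by
  set A : ℕ → ℝ := fun k =>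
    ∑ i ∈ Finset.range J, ‖v (i + 1) k - v i k‖ * (‖v (i + 1) k‖ + ‖v i k‖) with hA
  set B : ℕ → ℝ := fun j =>
    ∑ i ∈ Finset.range K, ‖v j (i + 1) - v j i‖ * (‖v j (i + 1)‖ + ‖v j i‖) with hB
  set n := ∑ j ∈ Finset.Ioo 0 J, ∑ k ∈ Finset.Ioo 0 K, ‖v j k‖ ^ 2 with hn
  set X := ∑ j ∈ Finset.range J, ∑ k ∈ Finset.range K, ‖deltaX hx v j k‖ ^ 2 with hX
  set Y := ∑ j ∈ Finset.range J, ∑ k ∈ Finset.range K, ‖deltaY hy v j k‖ ^ 2 with hY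
  -- One factor `‖v j k‖ ^ 2` is bounded along its row and the other along its column. The bounds
  -- depend on one index each, so the double sum splits into a product.
  have h4 : ∑ j ∈ Finset.Ioo 0 J, ∑ k ∈ Finset.Ioo 0 K, ‖v j k‖ ^ 4 ≤
      (∑ j ∈ Finset.Ioo 0 J, B j) * ∑ k ∈ Finset.Ioo 0 K, A k := by
    rw [Finset.sum_mul_sum]
    refine Finset.sum_le_sum fun j hj => Finset.sum_le_sum fun k hk => ?_
    rw [Finset.mem_Ioo] at hj hk
    have a1 : ‖v j k‖ ^ 2 ≤ A k := norm_sq_le_sum_diff (v := fun i => v i k)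
      (hv 0 (by omega) k (by omega) (by simp)) (by omega)
    have a2 : ‖v j k‖ ^ 2 ≤ B j := norm_sq_le_sum_diff (v := fun i => v j i)
      (hv j (by omega) 0 (by omega) (by simp)) (by omega)
    calc ‖v j k‖ ^ 4 = ‖v j k‖ ^ 2 * ‖v j k‖ ^ 2 := by ring
      _ ≤ B j * A k := mul_le_mul a2 a1 (by positivity) ((sq_nonneg _).trans a2)
  have hA2 : (∑ k ∈ Finset.Ioo 0 K, A k) ^ 2 ≤ (4 * n) * (hx ^ 2 * X) := by
    rw [hX, sum_deltaX_sq hhx hK hv, show 4 * n =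
      ∑ k ∈ Finset.Ioo 0 K, 4 * ∑ j ∈ Finset.Ioo 0 J, ‖v j k‖ ^ 2 by
        rw [hn, Finset.sum_comm, Finset.mul_sum]]
    refine Finset.sum_sq_le_sum_mul_sum_of_sq_le_mul _ (fun _ _ => by positivity)
      (fun _ _ => by positivity) fun k hk => ?_
    rw [Finset.mem_Ioo] at hk
    exact sq_sum_diff_le (v := fun i => v i k) hJ (hv 0 (by omega) k (by omega) (by simp))
      (hv J le_rfl k (by omega) (by simp))
  have hB2 : (∑ j ∈ Finset.Ioo 0 J, B j) ^ 2 ≤ (4 * n) * (hy ^ 2 * Y) := by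
    rw [hY, sum_deltaY_sq hhy hJ hv, show 4 * n =
      ∑ j ∈ Finset.Ioo 0 J, 4 * ∑ k ∈ Finset.Ioo 0 K, ‖v j k‖ ^ 2 by rw [hn, Finset.mul_sum]]
    refine Finset.sum_sq_le_sum_mul_sum_of_sq_le_mul _ (fun _ _ => by positivity)
      (fun _ _ => by positivity) fun j hj => ?_
    rw [Finset.mem_Ioo] at hj
    exact sq_sum_diff_le (v := fun i => v j i) hK (hv j (by omega) 0 (by omega) (by simp))
      (hv j (by omega) K le_rfl (by simp))
  set P := ∑ k ∈ Finset.Ioo 0 K, A k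
  set Q := ∑ j ∈ Finset.Ioo 0 J, B j
  -- The weights are chosen so that after Cauchy–Schwarz both terms carry the same factor `hx ^ 2 *
  -- hy ^ 2`, whatever the ratio of the mesh sizes.
  have h5 : 2 * (hx * hy) * (Q * P) ≤ hy ^ 2 * P ^ 2 + hx ^ 2 * Q ^ 2 := by
    nlinarith [sq_nonneg (hy * P - hx * Q)]
  have h6 : 2 * (hx * hy) * (Q * P) ≤ 2 * (2 * (hx * hy * n) * (hx * hy * X + hx * hy * Y)) := by
    calc _ ≤ hy ^ 2 * P ^ 2 + hx ^ 2 * Q ^ 2 := h5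
      _ ≤ hy ^ 2 * ((4 * n) * (hx ^ 2 * X)) + hx ^ 2 * ((4 * n) * (hy ^ 2 * Y)) := by gcongr
      _ = _ := by ring
  have h7 : hx * hy * (∑ j ∈ Finset.Ioo 0 J, ∑ k ∈ Finset.Ioo 0 K, ‖v j k‖ ^ 4) ≤
      hx * hy * (Q * P) := by gcongr
  unfold sqL2 sqH1
  linarith

end Grid

/-! ### Stability of the scheme -/

section Step

variable {hx hy τ lam : ℝ} {J K : ℕ}

theorem sqL2_le_of_forall (hhx : 0 < hx) (hhy : 0 < hy) {v : ℕ → ℕ → ℂ} {g : ℕ → ℕ → ℝ}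
    (h : ∀ j ∈ Finset.Ioo 0 J, ∀ k ∈ Finset.Ioo 0 K, ‖v j k‖ ^ 2 ≤ g j k) :
    sqL2 hx hy J K v ≤ hx * hy * ∑ j ∈ Finset.Ioo 0 J, ∑ k ∈ Finset.Ioo 0 K, g j k := by
  unfold sqL2
  gcongr with j hj k hk
  exact h j hj k hk

theorem mul_sum_const_le (hhx : 0 < hx) (hhy : 0 < hy) {B : ℝ} (hB : 0 ≤ B) :
    hx * hy * ∑ _j ∈ Finset.Ioo 0 J, ∑ _k ∈ Finset.Ioo 0 K, B ≤ (hx * J) * (hy * K) * B := by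
  simp only [Finset.sum_const, Nat.card_Ioo, nsmul_eq_mul]
  have h1 : ((J - 0 - 1 : ℕ) : ℝ) ≤ J := by exact_mod_cast (by omega : J - 0 - 1 ≤ J)
  have h2 : ((K - 0 - 1 : ℕ) : ℝ) ≤ K := by exact_mod_cast (by omega : K - 0 - 1 ≤ K)
  calc _ ≤ hx * hy * (J * (K * B)) := by gcongr
    _ = _ := by ring

/-- The identity obtained by testing a step of the scheme with its result. -/
theorem step_identity (hhx : 0 < hx) (hhy : 0 < hy) (hJ : 0 < J) (hK : 0 < K)
    {v w S : ℕ → ℕ → ℂ} (hw : VanishesOnBoundary J K w)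
    (h : ∀ j ∈ Finset.Ioo 0 J, ∀ k ∈ Finset.Ioo 0 K,
      Complex.I * ((w j k - v j k) / τ) + discreteLaplacian hx hy w j k = S j k) :
    (hx * hy : ℂ) * ∑ j ∈ Finset.Ioo 0 J, ∑ k ∈ Finset.Ioo 0 K,
      (S j k - Complex.I * ((w j k - v j k) / τ)) * (starRingEnd ℂ) (w j k) =
        -(sqH1 hx hy J K w : ℂ) := by
  rw [← sum_discreteLaplacian_mul_conj hhx hhy hJ hK hw]
  congr 1
  refine Finset.sum_congr rfl fun j hj => Finset.sum_congr rfl fun k hk => ?_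
  rw [← h j hj k hk]
  ring

/-- The subtracted last term is kept because its sum over the grid vanishes by the imaginary part of
`step_identity`. Completing the square in `‖w - v‖` absorbs the pairings of `F` and `R` with `w -
v`; the pairing of `R` with `v` is split by Young's inequality. -/
theorem pointwise_energy_le (hτ : 0 < τ) {v w F R : ℂ}
    (hF : |(F * (starRingEnd ℂ) v).im| ≤ ‖v‖ ^ 2) :
    ‖w‖ ^ 2 ≤ (1 + (4 * |lam| + 1) * τ) * ‖v‖ ^ 2 + 8 * τ ^ 2 * lam ^ 2 * ‖F‖ ^ 2 +
      (τ + 2 * τ ^ 2) * ‖R‖ ^ 2 -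
      2 * τ * (((2 * lam * F + R) - Complex.I * ((w - v) / τ)) * (starRingEnd ℂ) w).im := by
  have e : 2 * τ * (((2 * lam * F + R) - Complex.I * ((w - v) / τ)) * (starRingEnd ℂ) w).im =
      2 * τ * (2 * lam * (F * (starRingEnd ℂ) v).im + 2 * lam * (F * (starRingEnd ℂ) (w - v)).im +
        (R * (starRingEnd ℂ) v).im + (R * (starRingEnd ℂ) (w - v)).im) -
      (‖w‖ ^ 2 - ‖v‖ ^ 2 + ‖w - v‖ ^ 2) := by
    simp only [← Complex.normSq_eq_norm_sq, Complex.normSq_apply, Complex.mul_im, Complex.mul_re,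
      Complex.sub_re, Complex.sub_im, Complex.conj_re, Complex.conj_im, Complex.ofReal_re,
      Complex.ofReal_im, Complex.add_re, Complex.add_im, Complex.I_re, Complex.I_im,
      Complex.div_ofReal_re, Complex.div_ofReal_im, Complex.re_ofNat, Complex.im_ofNat]
    field_simp
    ring
  have im_le (x y : ℂ) : |(x * (starRingEnd ℂ) y).im| ≤ ‖x‖ * ‖y‖ :=
    (Complex.abs_im_le_norm _).trans (by rw [norm_mul, Complex.norm_conj])
  have a1 : 2 * lam * (F * (starRingEnd ℂ) v).im ≤ 2 * |lam| * ‖v‖ ^ 2 := by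
    refine (le_abs_self _).trans ?_
    rw [abs_mul, abs_mul, abs_two]; gcongr
  have a2 : 2 * lam * (F * (starRingEnd ℂ) (w - v)).im ≤ 2 * |lam| * (‖F‖ * ‖w - v‖) := by
    refine (le_abs_self _).trans ?_
    rw [abs_mul, abs_mul, abs_two]; gcongr; exact im_le _ _
  have a3 := (le_abs_self _).trans (im_le R v)
  have a4 := (le_abs_self _).trans (im_le R (w - v))
  have a5 : 2 * τ * (2 * lam * (F * (starRingEnd ℂ) v).im +
      2 * lam * (F * (starRingEnd ℂ) (w - v)).im +
        (R * (starRingEnd ℂ) v).im + (R * (starRingEnd ℂ) (w - v)).im) ≤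
      2 * τ * (2 * |lam| * ‖v‖ ^ 2 + 2 * |lam| * (‖F‖ * ‖w - v‖) + ‖R‖ * ‖v‖ +
        ‖R‖ * ‖w - v‖) := by gcongr
  rw [e]
  have a6 : 0 ≤ (‖w - v‖ - (2 * τ * |lam| * ‖F‖ + τ * ‖R‖)) ^ 2 := sq_nonneg _
  have a7 : 0 ≤ (2 * τ * |lam| * ‖F‖ - τ * ‖R‖) ^ 2 := sq_nonneg _
  have a8 : 0 ≤ τ * (‖R‖ - ‖v‖) ^ 2 := by positivity
  rw [← sq_abs lam]
  linear_combination a5 + a6 + a7 + a8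

/-- In the real part the product of `w` with its own conjugate drops out of the time difference,
leaving only `Im (v * conj w) / τ`. The loss of `1 / τ` here is the source of the factor `τ ^
(-1/2)` in the H¹ estimate. -/
theorem pointwise_gradient_le (hτ : 0 < τ) {v w F R : ℂ} :
    -(((2 * lam * F + R) - Complex.I * ((w - v) / τ)) * (starRingEnd ℂ) w).re ≤
      (‖v‖ ^ 2 / 2 + ‖w‖ ^ 2) / τ + 4 * τ * lam ^ 2 * ‖F‖ ^ 2 + τ * ‖R‖ ^ 2 := by
  have e : -(((2 * lam * F + R) - Complex.I * ((w - v) / τ)) * (starRingEnd ℂ) w).re =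
      (v * (starRingEnd ℂ) w).im / τ - ((2 * lam * F + R) * (starRingEnd ℂ) w).re := by
    simp only [Complex.mul_im, Complex.mul_re,
      Complex.sub_re, Complex.sub_im, Complex.conj_re, Complex.conj_im, Complex.ofReal_re,
      Complex.ofReal_im, Complex.add_re, Complex.add_im, Complex.I_re, Complex.I_im,
      Complex.div_ofReal_re, Complex.div_ofReal_im, Complex.re_ofNat, Complex.im_ofNat]
    field_simp
    ring
  have b1 : (v * (starRingEnd ℂ) w).im ≤ (‖v‖ ^ 2 + ‖w‖ ^ 2) / 2 := by
    have := (Complex.im_le_norm (v * (starRingEnd ℂ) w))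
    rw [norm_mul, Complex.norm_conj] at this
    nlinarith [sq_nonneg (‖v‖ - ‖w‖)]
  have b2 : -((2 * lam * F + R) * (starRingEnd ℂ) w).re ≤ (2 * |lam| * ‖F‖ + ‖R‖) * ‖w‖ := by
    refine (neg_le_abs _).trans ((Complex.abs_re_le_norm _).trans ?_)
    rw [norm_mul, Complex.norm_conj]
    gcongr
    refine (norm_add_le _ _).trans ?_
    simp
  have b3 : (2 * |lam| * ‖F‖ + ‖R‖) * ‖w‖ ≤
      τ * (2 * |lam| * ‖F‖ + ‖R‖) ^ 2 / 2 + ‖w‖ ^ 2 / (2 * τ) := by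
    rw [← sub_nonneg]
    have : τ * (2 * |lam| * ‖F‖ + ‖R‖) ^ 2 / 2 + ‖w‖ ^ 2 / (2 * τ) -
        (2 * |lam| * ‖F‖ + ‖R‖) * ‖w‖ =
        (τ * (2 * |lam| * ‖F‖ + ‖R‖) - ‖w‖) ^ 2 / (2 * τ) := by field_simp; ring
    rw [this]; positivity
  have b4 : 0 ≤ τ * (2 * |lam| * ‖F‖ - ‖R‖) ^ 2 := by positivity
  have b5 : (v * (starRingEnd ℂ) w).im / τ ≤ (‖v‖ ^ 2 + ‖w‖ ^ 2) / 2 / τ := by gcongr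
  have b6 : (‖v‖ ^ 2 / 2 + ‖w‖ ^ 2) / τ =
      (‖v‖ ^ 2 + ‖w‖ ^ 2) / 2 / τ + ‖w‖ ^ 2 / (2 * τ) := by field_simp; ring
  rw [e, b6, ← sq_abs lam]
  linear_combination b5 + b2 + b3 + b4 / 2

variable {v w F R : ℕ → ℕ → ℂ}

theorem energy_step (hhx : 0 < hx) (hhy : 0 < hy) (hτ : 0 < τ) (hJ : 0 < J) (hK : 0 < K)
    (hw : VanishesOnBoundary J K w)
    (h : ∀ j ∈ Finset.Ioo 0 J, ∀ k ∈ Finset.Ioo 0 K,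
      Complex.I * ((w j k - v j k) / τ) + discreteLaplacian hx hy w j k =
        2 * lam * F j k + R j k)
    (hF : ∀ j ∈ Finset.Ioo 0 J, ∀ k ∈ Finset.Ioo 0 K,
      |(F j k * (starRingEnd ℂ) (v j k)).im| ≤ ‖v j k‖ ^ 2) :
    sqL2 hx hy J K w ≤ (1 + (4 * |lam| + 1) * τ) * sqL2 hx hy J K v +
      8 * τ ^ 2 * lam ^ 2 * sqL2 hx hy J K F + (τ + 2 * τ ^ 2) * sqL2 hx hy J K R := by
  have h1 := congrArg Complex.im (step_identity hhx hhy hJ hK hw h)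
  rw [← Complex.ofReal_mul, Complex.im_ofReal_mul, Complex.neg_im, Complex.ofReal_im, neg_zero]
    at h1
  simp only [Complex.im_sum] at h1
  have h2 := sqL2_le_of_forall (J := J) (K := K) hhx hhy
    fun j hj k hk => pointwise_energy_le (lam := lam) (w := w j k) (R := R j k) hτ (hF j hj k hk)
  refine h2.trans (le_of_eq ?_)
  simp only [Finset.sum_sub_distrib, Finset.sum_add_distrib, ← Finset.mul_sum]
  unfold sqL2
  linear_combination -2 * τ * h1

theorem gradient_step (hhx : 0 < hx) (hhy : 0 < hy) (hτ : 0 < τ) (hJ : 0 < J) (hK : 0 < K)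
    (hw : VanishesOnBoundary J K w)
    (h : ∀ j ∈ Finset.Ioo 0 J, ∀ k ∈ Finset.Ioo 0 K,
      Complex.I * ((w j k - v j k) / τ) + discreteLaplacian hx hy w j k =
        2 * lam * F j k + R j k) :
    sqH1 hx hy J K w ≤ (sqL2 hx hy J K v / 2 + sqL2 hx hy J K w) / τ +
      4 * τ * lam ^ 2 * sqL2 hx hy J K F + τ * sqL2 hx hy J K R := by
  have h1 := congrArg Complex.re (step_identity hhx hhy hJ hK hw h)
  rw [← Complex.ofReal_mul, Complex.re_ofReal_mul, Complex.neg_re, Complex.ofReal_re] at h1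
  simp only [Complex.re_sum] at h1
  have h2 : hx * hy * ∑ j ∈ Finset.Ioo 0 J, ∑ k ∈ Finset.Ioo 0 K,
      -(((2 * lam * F j k + R j k) - Complex.I * ((w j k - v j k) / τ)) *
        (starRingEnd ℂ) (w j k)).re ≤ hx * hy * ∑ j ∈ Finset.Ioo 0 J, ∑ k ∈ Finset.Ioo 0 K,
      ((‖v j k‖ ^ 2 / 2 + ‖w j k‖ ^ 2) / τ + 4 * τ * lam ^ 2 * ‖F j k‖ ^ 2 + τ * ‖R j k‖ ^ 2) := by
    gcongr with j hj k hk
    exact pointwise_gradient_le hτ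
  simp only [Finset.sum_add_distrib, ← Finset.mul_sum, ← Finset.sum_div, Finset.sum_neg_distrib]
    at h2
  unfold sqL2
  linear_combination h2 + h1

end Step

/-- One induction step. The smallness `hvH` of the old gradient is used solely to control the
quartic term. The new gradient bound is conditional on `sqL2 hx hy J K w ≤ E₀ * δ ^ 2`, because that
bound comes from Gronwall over all steps and not from a single one. -/
theorem stability_step {hx hy τ lam A area C₁ δ B D E₀ E₁ : ℝ} {J K : ℕ} {v w F R : ℕ → ℕ → ℂ}
    (hhx : 0 < hx) (hhy : 0 < hy) (hτ : 0 < τ) (hτ1 : τ ≤ 1) (hJ : 0 < J) (hK : 0 < K)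
    (harea : (hx * J) * (hy * K) = area) (hC₁ : 0 ≤ C₁) (hτδ : τ ≤ δ)
    (hv : VanishesOnBoundary J K v) (hw : VanishesOnBoundary J K w)
    (hstep : ∀ j ∈ Finset.Ioo 0 J, ∀ k ∈ Finset.Ioo 0 K,
      Complex.I * ((w j k - v j k) / τ) + discreteLaplacian hx hy w j k =
        2 * lam * F j k + R j k)
    (hFim : ∀ j ∈ Finset.Ioo 0 J, ∀ k ∈ Finset.Ioo 0 K,
      |(F j k * (starRingEnd ℂ) (v j k)).im| ≤ ‖v j k‖ ^ 2)
    (hF : ∀ j ∈ Finset.Ioo 0 J, ∀ k ∈ Finset.Ioo 0 K,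
      τ * ‖F j k‖ ^ 2 ≤ C₁ * (‖v j k‖ ^ 2 + τ ^ 2 + τ * ‖v j k‖ ^ 4))
    (hR : ∀ j ∈ Finset.Ioo 0 J, ∀ k ∈ Finset.Ioo 0 K, ‖R j k‖ ≤ A * δ)
    (hB : B = 4 * |lam| + 1 + 16 * lam ^ 2 * C₁)
    (hD : D = 8 * lam ^ 2 * C₁ * area + 3 * area * A ^ 2)
    (hE₁ : E₁ = 3 / 2 * E₀ + 4 * lam ^ 2 * C₁ * (2 * E₀ + area) + area * A ^ 2)
    (hvE : sqL2 hx hy J K v ≤ E₀ * δ ^ 2)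
    (hvH : 2 * (τ * sqH1 hx hy J K v) ≤ 1) :
    sqL2 hx hy J K w ≤ (1 + B * τ) * sqL2 hx hy J K v + τ * D * δ ^ 2 ∧
      (sqL2 hx hy J K w ≤ E₀ * δ ^ 2 → τ * sqH1 hx hy J K w ≤ E₁ * δ ^ 2) := by
  have harea0 : 0 ≤ area := by rw [← harea]; positivity
  have hv0 := sqL2_nonneg (J := J) (K := K) hhx hhy v
  have hlad := sum_norm_pow_four_le hhx hhy hJ hK hv
  -- By `hvH` the factor 2 from the Ladyzhenskaya inequality is exactly compensated, so the quartic
  -- term counts as one more copy of `sqL2 hx hy J K v`.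
  have hlad2 : τ * (hx * hy * ∑ j ∈ Finset.Ioo 0 J, ∑ k ∈ Finset.Ioo 0 K, ‖v j k‖ ^ 4) ≤
      sqL2 hx hy J K v := by
    calc _ ≤ τ * (2 * sqL2 hx hy J K v * sqH1 hx hy J K v) := by gcongr
      _ = sqL2 hx hy J K v * (2 * (τ * sqH1 hx hy J K v)) := by ring
      _ ≤ sqL2 hx hy J K v * 1 := by gcongr
      _ = _ := mul_one _
  have hFn : τ * sqL2 hx hy J K F ≤ C₁ * (2 * sqL2 hx hy J K v + τ ^ 2 * area) := by
    have h1 : τ * sqL2 hx hy J K F ≤ hx * hy * ∑ j ∈ Finset.Ioo 0 J, ∑ k ∈ Finset.Ioo 0 K,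
        C₁ * (‖v j k‖ ^ 2 + τ ^ 2 + τ * ‖v j k‖ ^ 4) := by
      unfold sqL2
      rw [mul_left_comm]
      gcongr
      simp only [Finset.mul_sum]
      exact Finset.sum_le_sum fun j hj => Finset.sum_le_sum fun k hk => hF j hj k hk
    have h2 := mul_sum_const_le (J := J) (K := K) hhx hhy (sq_nonneg τ)
    rw [harea] at h2
    calc _ ≤ _ := h1
      _ = C₁ * (sqL2 hx hy J K v +
          hx * hy * ∑ _j ∈ Finset.Ioo 0 J, ∑ _k ∈ Finset.Ioo 0 K, τ ^ 2 +
          τ * (hx * hy * ∑ j ∈ Finset.Ioo 0 J, ∑ k ∈ Finset.Ioo 0 K, ‖v j k‖ ^ 4)) := by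
        simp only [← Finset.mul_sum, Finset.sum_add_distrib]
        unfold sqL2
        ring
      _ ≤ C₁ * (sqL2 hx hy J K v + area * τ ^ 2 + sqL2 hx hy J K v) := by gcongr
      _ = _ := by ring
  have hRn : sqL2 hx hy J K R ≤ area * (A ^ 2 * δ ^ 2) := by
    refine (sqL2_le_of_forall (g := fun _ _ => A ^ 2 * δ ^ 2) hhx hhy fun j hj k hk => ?_).trans ?_
    · rw [← mul_pow]; gcongr; exact hR j hj k hk
    · rw [← harea]; exact mul_sum_const_le hhx hhy (by positivity)
  have hτ2 : τ ^ 2 ≤ δ ^ 2 := by gcongr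
  have hττ : τ ^ 2 ≤ τ := by nlinarith
  have hw2 := energy_step hhx hhy hτ hJ hK hw hstep hFim
  have hwH := gradient_step hhx hhy hτ hJ hK hw hstep
  have hR0 := sqL2_nonneg (J := J) (K := K) hhx hhy R
  have hF0 := sqL2_nonneg (J := J) (K := K) hhx hhy F
  generalize sqL2 hx hy J K v = x at *
  generalize sqL2 hx hy J K w = x' at *
  generalize sqH1 hx hy J K w = y' at *
  generalize sqL2 hx hy J K R = r at *
  generalize sqL2 hx hy J K F = G at *
  -- Only `τ * G` is controlled, so the factor `τ ^ 2` in the energy estimate is read as `τ` times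
  -- this quantity.
  obtain ⟨g, hg⟩ : ∃ g, g = τ * G := ⟨_, rfl⟩
  rw [← hg] at hFn
  have hg0 : 0 ≤ g := by rw [hg]; positivity
  have hg1 : g ≤ C₁ * (2 * x + δ ^ 2 * area) := hFn.trans (by gcongr)
  constructor
  · calc _ ≤ _ := hw2
      _ = (1 + (4 * |lam| + 1) * τ) * x + 8 * τ * lam ^ 2 * g + (τ + 2 * τ ^ 2) * r := by
        rw [hg]; ring
      _ ≤ (1 + (4 * |lam| + 1) * τ) * x + 8 * τ * lam ^ 2 * (C₁ * (2 * x + δ ^ 2 * area)) +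
          (τ + 2 * τ) * (area * (A ^ 2 * δ ^ 2)) := by gcongr
      _ = _ := by rw [hB, hD]; ring
  · intro hx'
    have hg2 : g ≤ C₁ * (2 * (E₀ * δ ^ 2) + δ ^ 2 * area) := hg1.trans (by gcongr)
    have hτ3 : τ ^ 2 ≤ 1 := hττ.trans hτ1
    calc τ * y' ≤ τ * _ := mul_le_mul_of_nonneg_left hwH hτ.le
      _ = x / 2 + x' + 4 * τ * lam ^ 2 * g + τ ^ 2 * r := by rw [hg]; field_simp
      _ ≤ E₀ * δ ^ 2 / 2 + E₀ * δ ^ 2 +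
          4 * 1 * lam ^ 2 * (C₁ * (2 * (E₀ * δ ^ 2) + δ ^ 2 * area)) +
          1 * (area * (A ^ 2 * δ ^ 2)) := by gcongr
      _ = _ := by rw [hE₁]; ring

/-- The convergence estimate for grid functions `e n` which satisfy the linearized BDF1 scheme with
the nonlinear terms `F n` and the local truncation errors `R n`. -/
theorem stability {hx hy τ lam A area C₁ δ T : ℝ} {J K N : ℕ} {e F R : ℕ → ℕ → ℕ → ℂ}
    (hhx : 0 < hx) (hhy : 0 < hy) (hτ : 0 < τ) (hτ1 : τ ≤ 1) (hJ : 0 < J) (hK : 0 < K)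
    (harea : (hx * J) * (hy * K) = area) (hT : N * τ = T) (hC₁ : 0 ≤ C₁)
    (hτδ : τ ≤ δ)
    (hvan : ∀ n ≤ N, VanishesOnBoundary J K (e n))
    (hinit : ∀ j ≤ J, ∀ k ≤ K, e 0 j k = 0)
    (hstep : ∀ n < N, ∀ j ∈ Finset.Ioo 0 J, ∀ k ∈ Finset.Ioo 0 K,
      Complex.I * ((e (n + 1) j k - e n j k) / τ) + discreteLaplacian hx hy (e (n + 1)) j k =
        2 * lam * F n j k + R n j k)
    (hFim : ∀ n < N, ∀ j ∈ Finset.Ioo 0 J, ∀ k ∈ Finset.Ioo 0 K,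
      |(F n j k * (starRingEnd ℂ) (e n j k)).im| ≤ ‖e n j k‖ ^ 2)
    (hF : ∀ n < N, ∀ j ∈ Finset.Ioo 0 J, ∀ k ∈ Finset.Ioo 0 K,
      τ * ‖F n j k‖ ^ 2 ≤ C₁ * (‖e n j k‖ ^ 2 + τ ^ 2 + τ * ‖e n j k‖ ^ 4))
    (hR : ∀ n < N, ∀ j ∈ Finset.Ioo 0 J, ∀ k ∈ Finset.Ioo 0 K, ‖R n j k‖ ≤ A * δ)
    {B D E₀ E₁ : ℝ} (hB : B = 4 * |lam| + 1 + 16 * lam ^ 2 * C₁)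
    (hD : D = 8 * lam ^ 2 * C₁ * area + 3 * area * A ^ 2)
    (hE₀ : E₀ = Real.exp (B * T) * T * D)
    (hE₁ : E₁ = 3 / 2 * E₀ + 4 * lam ^ 2 * C₁ * (2 * E₀ + area) + area * A ^ 2)
    (hsmall : 2 * (E₁ * δ ^ 2) ≤ 1) :
    ∀ n ≤ N, sqL2 hx hy J K (e n) ≤ E₀ * δ ^ 2 ∧ τ * sqH1 hx hy J K (e n) ≤ E₁ * δ ^ 2 := by
  have harea0 : 0 ≤ area := by rw [← harea]; positivity
  have hB0 : 0 ≤ B := by rw [hB]; positivity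
  have hD0 : 0 ≤ D := by rw [hD]; positivity
  have hT0 : 0 ≤ T := by rw [← hT]; positivity
  have hE₀0 : 0 ≤ E₀ := by rw [hE₀]; positivity
  have hE₁0 : 0 ≤ E₁ := by rw [hE₁]; positivity
  -- Discrete Gronwall: `(1 + B * τ) ^ n ≤ exp (B * T)`, and the accumulated sources amount to at
  -- most `T * D`.
  have growth (n : ℕ) (hn : n ≤ N) : (1 + B * τ) ^ n * (n * τ) * D ≤ E₀ := by
    have h1 : (n : ℝ) * τ ≤ T := by
      rw [← hT]; gcongr
    rw [hE₀]
    gcongr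
    calc (1 + B * τ) ^ n ≤ (Real.exp (B * τ)) ^ n := by
          gcongr; linarith [Real.add_one_le_exp (B * τ)]
      _ = Real.exp (B * (n * τ)) := by rw [← Real.exp_nat_mul]; ring_nf
      _ ≤ _ := by gcongr
  -- The induction needs the bound with explicit dependence on `n`, since a single step does not
  -- reproduce the uniform constant `E₀`.
  suffices H : ∀ n ≤ N, sqL2 hx hy J K (e n) ≤ (1 + B * τ) ^ n * (n * τ) * D * δ ^ 2 ∧
      τ * sqH1 hx hy J K (e n) ≤ E₁ * δ ^ 2 by
    intro n hn
    refine ⟨(H n hn).1.trans ?_, (H n hn).2⟩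
    gcongr
    exact growth n hn
  intro n
  induction n with
  | zero =>
    intro _
    have e1 : sqL2 hx hy J K (e 0) = 0 := by
      rw [sqL2, Finset.sum_eq_zero, mul_zero]
      intro j hj
      refine Finset.sum_eq_zero fun k hk => ?_
      rw [Finset.mem_Ioo] at hj hk
      rw [hinit j (by omega) k (by omega)]; simp
    have e2 : sqH1 hx hy J K (e 0) = 0 := by
      rw [sqH1, Finset.sum_eq_zero, Finset.sum_eq_zero, mul_zero, add_zero]
      all_goals
        intro j hj
        refine Finset.sum_eq_zero fun k hk => ?_
        rw [Finset.mem_range] at hj hk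
        simp only [deltaX, deltaY]
        rw [hinit j (by omega) k (by omega)]
      · rw [hinit j (by omega) (k + 1) (by omega)]; simp
      · rw [hinit (j + 1) (by omega) k (by omega)]; simp
    rw [e1, e2]
    constructor
    · simp
    · rw [mul_zero]; positivity
  | succ n ih =>
    intro hn
    obtain ⟨ih1, ih2⟩ := ih (by omega)
    have hn' : n < N := by omega
    have ihE : sqL2 hx hy J K (e n) ≤ E₀ * δ ^ 2 :=
      ih1.trans (by gcongr; exact growth n (by omega))
    obtain ⟨hnew, hH⟩ := stability_step hhx hhy hτ hτ1 hJ hK harea hC₁ hτδ (hvan n (by omega))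
      (hvan (n + 1) hn) (hstep n hn') (hFim n hn') (hF n hn') (hR n hn') hB hD hE₁ ihE
      (by linarith)
    have hnew1 : sqL2 hx hy J K (e (n + 1)) ≤
        (1 + B * τ) ^ (n + 1) * ((n + 1 : ℕ) * τ) * D * δ ^ 2 := by
      have h1 : 1 ≤ (1 + B * τ) ^ (n + 1) := one_le_pow₀ (by nlinarith)
      have h2 : τ * D * δ ^ 2 ≤ (1 + B * τ) ^ (n + 1) * (τ * D * δ ^ 2) :=
        le_mul_of_one_le_left (by positivity) h1
      calc _ ≤ _ := hnew
        _ ≤ (1 + B * τ) * ((1 + B * τ) ^ n * (n * τ) * D * δ ^ 2) +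
            (1 + B * τ) ^ (n + 1) * (τ * D * δ ^ 2) := by
          gcongr
        _ = _ := by push_cast; ring
    exact ⟨hnew1, hH (hnew1.trans (by gcongr; exact growth (n + 1) hn))⟩

/-! ### Pairings with test functions -/

/-- A bump function concentrated where `R` is within `ε` of `R z` makes the pairing nearly `R z`
times its mass. Continuity carries the bound to the closure. -/
theorem norm_le_of_forall_test {O : Set (ℝ × ℝ)} (hO : IsOpen O) (hc : IsCompact (closure O))
    {R : ℝ × ℝ → ℂ} (hR : ContinuousOn R (closure O)) {B : ℝ}
    (h : ∀ φ : ℝ × ℝ → ℝ, IsTestFunction O φ → (∀ z, 0 ≤ φ z) →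
      ‖∫ z in O, R z * (φ z : ℂ)‖ ≤ B * ∫ z, φ z) :
    ∀ z ∈ closure O, ‖R z‖ ≤ B := by
  have key : ∀ z ∈ O, ‖R z‖ ≤ B := by
    intro z hz
    refine le_of_forall_pos_le_add fun ε hε => ?_
    have hRz : ContinuousAt R z := hR.continuousAt (Filter.mem_of_superset (hO.mem_nhds hz)
      subset_closure)
    have hs : O ∩ {y | ‖R y - R z‖ < ε} ∈ nhds z := by
      refine Filter.inter_mem (hO.mem_nhds hz) ?_
      have := Metric.continuousAt_iff'.1 hRz ε hε
      simp only [dist_eq_norm] at this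
      exact this
    obtain ⟨φ, hφs, hφc, hφd, hφr, hφ1⟩ := exists_contDiff_tsupport_subset (n := ⊤) hs
    have hφ0 : ∀ y, 0 ≤ φ y := fun y => (hφr ⟨y, rfl⟩).1
    have hpos : 0 < ∫ y, φ y := hφd.continuous.integral_pos_of_hasCompactSupport_nonneg_nonzero hφc
      hφ0 (x := z) (by rw [hφ1]; exact one_ne_zero)
    have hint : Integrable φ := hφd.continuous.integrable_of_hasCompactSupport hφc
    have hmem : ∀ y, φ y ≠ 0 → y ∈ O ∩ {y | ‖R y - R z‖ < ε} :=
      fun y hy => hφs (subset_tsupport _ hy)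
    have hOint : ∫ y in O, φ y = ∫ y, φ y :=
      setIntegral_eq_integral_of_forall_compl_eq_zero fun y hy => by
        by_contra hne
        exact hy (hmem y hne).1
    have hI1 : IntegrableOn (fun y => R y * (φ y : ℂ)) O :=
      ((hR.mul (Complex.continuous_ofReal.comp hφd.continuous).continuousOn).integrableOn_compact
        hc).mono_set subset_closure
    have hI2 : IntegrableOn (fun y => R z * (φ y : ℂ)) O := (hint.ofReal.const_mul _).integrableOn
    have e1 : ∫ y in O, R z * (φ y : ℂ) = R z * ((∫ y, φ y : ℝ) : ℂ) := by
      rw [integral_const_mul, ← hOint, integral_complex_ofReal]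
    have e2 : R z * ((∫ y, φ y : ℝ) : ℂ) = (∫ y in O, R y * (φ y : ℂ)) -
        ∫ y in O, (R y - R z) * (φ y : ℂ) := by
      simp only [sub_mul]
      rw [integral_sub hI1 hI2, e1, sub_sub_cancel]
    have e3 : ‖∫ y in O, (R y - R z) * (φ y : ℂ)‖ ≤ ε * ∫ y, φ y := by
      rw [← hOint, ← integral_const_mul]
      refine norm_integral_le_of_norm_le (hint.const_mul ε).integrableOn
        (Filter.Eventually.of_forall fun y => ?_)
      rw [norm_mul, Complex.norm_real, Real.norm_of_nonneg (hφ0 y)]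
      by_cases hy : φ y = 0
      · simp [hy]
      · have := (hmem y hy).2
        have h2 := hφ0 y
        gcongr
        exact this.le
    have e4 : ‖R z‖ * ∫ y, φ y ≤ (B + ε) * ∫ y, φ y := by
      calc ‖R z‖ * ∫ y, φ y = ‖R z * ((∫ y, φ y : ℝ) : ℂ)‖ := by
            rw [norm_mul, Complex.norm_real, Real.norm_of_nonneg hpos.le]
        _ ≤ B * (∫ y, φ y) + ε * ∫ y, φ y := by
            rw [e2]
            exact (norm_sub_le _ _).trans (add_le_add (h φ ⟨hφd, hφc, hφs.trans inter_subset_left⟩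
              hφ0) e3)
        _ = _ := by ring
    exact le_of_mul_le_mul_right e4 hpos
  intro z hz
  refine closure_minimal (s := (fun z => ‖R z‖) '' O) ?_ isClosed_Iic
    (hR.norm.image_closure ⟨z, hz, rfl⟩)
  rintro _ ⟨y, hy, rfl⟩
  exact key y hy

/-- The pairing `g ↦ ∫_Ω g φ` of `L^∞(Ω)` with a smooth compactly supported function. -/
def testPairing (Ω : Set (ℝ × ℝ)) {φ : ℝ × ℝ → ℝ} (h : ContDiff ℝ ∞ φ) (hc : HasCompactSupport φ) :
    LInf Ω →L[ℝ] ℂ :=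
  LinearMap.mkContinuous
    { toFun := fun g => ∫ z in Ω, g z * (φ z : ℂ)
      map_add' := fun u v => by
        rw [← integral_add (integrable_mul_test u h hc) (integrable_mul_test v h hc)]
        refine integral_congr_ae ?_
        filter_upwards [Lp.coeFn_add u v] with z hz
        rw [hz, Pi.add_apply, add_mul]
      map_smul' := fun r u => by
        rw [RingHom.id_apply, Complex.real_smul, ← integral_const_mul]
        refine integral_congr_ae ?_
        filter_upwards [Lp.coeFn_smul r u] with z hz
        rw [hz, Pi.smul_apply, Complex.real_smul, mul_assoc] }
    (∫ z, |φ z|) fun g => by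
      have hint : Integrable (fun z => |φ z|) :=
        (h.continuous.integrable_of_hasCompactSupport hc).abs
      have hb : ∀ᵐ z ∂(volume.restrict Ω), ‖g z‖ ≤ ‖g‖ := by
        have := ae_le_eLpNormEssSup (f := (g : ℝ × ℝ → ℂ)) (μ := volume.restrict Ω)
        filter_upwards [this] with z hz
        rw [Lp.norm_def, eLpNorm_exponent_top, ← toReal_enorm]
        exact ENNReal.toReal_mono (by simpa using Lp.eLpNorm_ne_top g) hz
      calc ‖∫ z in Ω, g z * (φ z : ℂ)‖ ≤ ∫ z in Ω, ‖g‖ * |φ z| := by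
            refine norm_integral_le_of_norm_le (hint.const_mul _).integrableOn ?_
            filter_upwards [hb] with z hz
            rw [norm_mul, Complex.norm_real, Real.norm_eq_abs]
            gcongr
        _ = (∫ z in Ω, |φ z|) * ‖g‖ := by rw [integral_const_mul, mul_comm]
        _ ≤ (∫ z, |φ z|) * ‖g‖ := by
            gcongr
            · exact Filter.Eventually.of_forall fun _ => abs_nonneg _
            · exact Measure.restrict_le_self

theorem testPairing_apply {Ω : Set (ℝ × ℝ)} {φ : ℝ × ℝ → ℝ} (h : ContDiff ℝ ∞ φ)
    (hc : HasCompactSupport φ) (g : LInf Ω) :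
    testPairing Ω h hc g = ∫ z in Ω, g z * (φ z : ℂ) := rfl

theorem norm_testPairing_le {Ω : Set (ℝ × ℝ)} {φ : ℝ × ℝ → ℝ} (h : ContDiff ℝ ∞ φ)
    (hc : HasCompactSupport φ) (g : LInf Ω) :
    ‖testPairing Ω h hc g‖ ≤ ‖g‖ * ∫ z, |φ z| := by
  rw [mul_comm]
  exact (testPairing Ω h hc).le_of_opNorm_le
    (LinearMap.mkContinuous_norm_le _ (integral_nonneg fun _ => abs_nonneg _) _) g

/-- The derivative of `ψ` in the direction `v`. -/
abbrev dirDeriv (v : ℝ × ℝ) (ψ : ℝ × ℝ → ℝ) : ℝ × ℝ → ℝ := fun z => fderiv ℝ ψ z v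

/-- Translating the test function makes the pairing smooth in the shift even though `g` is merely in
L^∞, so one-variable calculus applies. -/
theorem hasDerivAt_integral_shift {Ω : Set (ℝ × ℝ)} [IsFiniteMeasure (volume.restrict Ω)]
    (g : LInf Ω) {ψ : ℝ × ℝ → ℝ} (h : ContDiff ℝ ∞ ψ) (hc : HasCompactSupport ψ) (v : ℝ × ℝ)
    (s : ℝ) :
    HasDerivAt (fun s : ℝ => ∫ z in Ω, g z * (ψ (z + s • v) : ℂ))
      (∫ z in Ω, g z * (dirDeriv v ψ (z + s • v) : ℂ)) s := by
  have hshift (s : ℝ) : ContDiff ℝ ∞ (fun z => ψ (z + s • v)) :=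
    h.comp (contDiff_id.add contDiff_const)
  have hcshift (s : ℝ) : HasCompactSupport (fun z => ψ (z + s • v)) :=
    hc.comp_homeomorph (Homeomorph.addRight (s • v))
  obtain ⟨hd, hdc⟩ := smooth_dir h hc v
  obtain ⟨C, hC⟩ := hd.continuous.bounded_above_of_compact_support hdc
  refine (hasDerivAt_integral_of_dominated_loc_of_deriv_le (s := univ) Filter.univ_mem
    (F := fun (s : ℝ) z => g z * (ψ (z + s • v) : ℂ))
    (F' := fun (s : ℝ) z => g z * (dirDeriv v ψ (z + s • v) : ℂ)) (bound := fun z => ‖g z‖ * C)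
    (Filter.Eventually.of_forall fun s => (integrable_mul_test g (hshift s) (hcshift s)).1)
    (integrable_mul_test g (hshift s) (hcshift s)) ?_ ?_ ?_ ?_).2
  · refine (Lp.aestronglyMeasurable g).mul (Continuous.aestronglyMeasurable ?_)
    exact Complex.continuous_ofReal.comp (hd.continuous.comp (continuous_id.add continuous_const))
  · refine Filter.Eventually.of_forall fun z s _ => ?_
    rw [norm_mul, Complex.norm_real]
    gcongr
    exact hC _
  · exact (((Lp.memLp g).integrable le_top).norm).mul_const C
  · refine Filter.Eventually.of_forall fun z s _ => ?_
    refine HasDerivAt.const_mul _ (HasDerivAt.ofReal_comp ?_)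
    have h1 : HasFDerivAt ψ (fderiv ℝ ψ (z + s • v)) (z + s • v) :=
      (h.differentiable (by simp) _).hasFDerivAt
    have h2 : HasDerivAt (fun s : ℝ => z + s • v) v s := by
      simpa using ((hasDerivAt_id s).smul_const v).const_add z
    exact h1.comp_hasDerivAt s h2

/-! ### Taylor estimates for second differences -/

theorem norm_le_of_norm_deriv_le {H H' : ℝ → ℂ} {C h : ℝ} (h0 : H 0 = 0)
    (hd : ∀ s, HasDerivAt H (H' s) s) (hC : 0 ≤ C) (hb : ∀ s ∈ Icc 0 h, ‖H' s‖ ≤ C) :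
    ∀ s ∈ Icc 0 h, ‖H s‖ ≤ C * h := by
  intro s hs
  have := norm_image_sub_le_of_norm_deriv_le_segment' (a := 0) (b := h)
    (fun x _ => (hd x).hasDerivWithinAt) (fun x hx => hb x (Ico_subset_Icc_self hx)) s hs
  rw [h0, sub_zero, sub_zero] at this
  exact this.trans (by gcongr; exact hs.2)

/-- Symmetrization in `s` yields a chain of functions vanishing at 0, each the derivative of the
next. Four applications of the mean value inequality give one factor `h` each; the constant 2 is not
optimal. -/
theorem norm_secondDifference_sub_le {G₀ G₁ G₂ G₃ G₄ : ℝ → ℂ} {B h : ℝ} (hh : 0 ≤ h)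
    (h0 : ∀ s, HasDerivAt G₀ (G₁ s) s) (h1 : ∀ s, HasDerivAt G₁ (G₂ s) s)
    (h2 : ∀ s, HasDerivAt G₂ (G₃ s) s) (h3 : ∀ s, HasDerivAt G₃ (G₄ s) s)
    (hB : ∀ s ∈ Icc (-h) h, ‖G₄ s‖ ≤ B) :
    ‖G₀ h - 2 * G₀ 0 + G₀ (-h) - h ^ 2 * G₂ 0‖ ≤ 2 * B * h ^ 4 := by
  have hB0 : 0 ≤ B := (norm_nonneg _).trans (hB 0 ⟨by linarith, hh⟩)
  have neg {G G' : ℝ → ℂ} (hG : ∀ s, HasDerivAt G (G' s) s) (s : ℝ) :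
      HasDerivAt (fun s => G (-s)) (-G' (-s)) s := by
    exact ((hG (-s)).scomp s (hasDerivAt_neg s)).congr_deriv (by simp)
  have b4 : ∀ s ∈ Icc 0 h, ‖G₄ s + G₄ (-s)‖ ≤ 2 * B := by
    intro s hs
    have h1 := hB s ⟨by linarith [hs.1], hs.2⟩
    have h2 := hB (-s) ⟨by linarith [hs.2], by linarith [hs.1]⟩
    exact (norm_add_le _ _).trans (by linarith)
  have b3 := norm_le_of_norm_deriv_le (H := fun s => G₃ s - G₃ (-s))
    (H' := fun s => G₄ s + G₄ (-s)) (by simp)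
    (fun s => ((h3 s).sub (neg h3 s)).congr_deriv (by simp)) (by positivity) b4
  have b2 := norm_le_of_norm_deriv_le (H := fun s => G₂ s + G₂ (-s) - 2 * G₂ 0)
    (H' := fun s => G₃ s - G₃ (-s)) (by simp; ring)
    (fun s => (((h2 s).add (neg h2 s)).sub_const (2 * G₂ 0)).congr_deriv (by ring)) (by positivity) b3
  have b1 := norm_le_of_norm_deriv_le (H := fun s : ℝ => G₁ s - G₁ (-s) - (s : ℂ) * (2 * G₂ 0))
    (H' := fun s => G₂ s + G₂ (-s) - 2 * G₂ 0) (by simp)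
    (fun s => (((h1 s).sub (neg h1 s)).sub
      ((hasDerivAt_id s).ofReal_comp.mul_const (2 * G₂ 0))).congr_deriv (by simp)) (by positivity) b2
  have b0 := norm_le_of_norm_deriv_le
    (H := fun s : ℝ => G₀ s + G₀ (-s) - (s : ℂ) ^ 2 * G₂ 0 - 2 * G₀ 0)
    (H' := fun s : ℝ => G₁ s - G₁ (-s) - (s : ℂ) * (2 * G₂ 0)) (by simp; ring)
    (fun s => ((((h0 s).add (neg h0 s)).sub ((((hasDerivAt_id s).ofReal_comp).pow 2).mul_const
      (G₂ 0))).sub_const (2 * G₀ 0)).congr_deriv (by simp; ring)) (by positivity) b1 h ⟨hh, le_rfl⟩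
  calc _ = ‖G₀ h + G₀ (-h) - (h : ℂ) ^ 2 * G₂ 0 - 2 * G₀ 0‖ := by congr 1; ring
    _ ≤ _ := b0
    _ = _ := by ring

/-- The fourth derivative in the shift falls on the test function; `hw` moves it to `w`, and
translation invariance of the integral makes the resulting bound independent of the shift. -/
theorem norm_secondDifference_integral_sub_le {Ω : Set (ℝ × ℝ)}
    [IsFiniteMeasure (volume.restrict Ω)] (g w : LInf Ω) {φ : ℝ × ℝ → ℝ} (hφ : ContDiff ℝ ∞ φ)
    (hc : HasCompactSupport φ) (v : ℝ × ℝ) {h : ℝ} (hh : 0 ≤ h)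
    (hw : ∀ s ∈ Icc (-h) h, ∫ z in Ω, g z * (((dirDeriv v)^[4] φ) (z + s • v) : ℂ) =
      ∫ z in Ω, w z * (φ (z + s • v) : ℂ)) :
    ‖(∫ z in Ω, g z * (φ (z + h • v) : ℂ)) - 2 * (∫ z in Ω, g z * (φ z : ℂ)) +
      (∫ z in Ω, g z * (φ (z + (-h) • v) : ℂ)) -
      h ^ 2 * ∫ z in Ω, g z * (((dirDeriv v)^[2] φ) z : ℂ)‖ ≤
      2 * (‖w‖ * ∫ z, |φ z|) * h ^ 4 := by
  have hd (n : ℕ) (s : ℝ) := hasDerivAt_integral_shift g (smooth_iter hφ hc v n).1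
    (smooth_iter hφ hc v n).2 v s
  have key := norm_secondDifference_sub_le hh (hd 0) (hd 1) (hd 2) (hd 3)
    (B := ‖w‖ * ∫ z, |φ z|) fun s hs => by
      refine (le_of_eq (congrArg norm (hw s hs))).trans ?_
      have h1 : ContDiff ℝ ∞ (fun z => φ (z + s • v)) := hφ.comp (contDiff_id.add contDiff_const)
      have h2 : HasCompactSupport (fun z => φ (z + s • v)) :=
        hc.comp_homeomorph (Homeomorph.addRight (s • v))
      have h3 := norm_testPairing_le h1 h2 w
      rwa [integral_add_right_eq_self (fun z => |φ z|)] at h3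
  simpa using key

theorem setIntegral_shift {O Ω : Set (ℝ × ℝ)} (F : ℝ × ℝ → ℂ) {φ : ℝ × ℝ → ℝ} (y : ℝ × ℝ)
    (hO : ∀ z, φ z ≠ 0 → z ∈ O) (hΩ : ∀ z, φ (z - y) ≠ 0 → z ∈ Ω) :
    ∫ z in O, F (z + y) * (φ z : ℂ) = ∫ z in Ω, F z * (φ (z - y) : ℂ) := by
  rw [setIntegral_eq_integral_of_forall_compl_eq_zero,
    setIntegral_eq_integral_of_forall_compl_eq_zero,
    ← integral_add_right_eq_self (fun z => F z * (φ (z - y) : ℂ)) y]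
  · simp
  · intro z hz
    have : φ (z - y) = 0 := by by_contra hne; exact hz (hΩ z hne)
    simp [this]
  · intro z hz
    have : φ z = 0 := by by_contra hne; exact hz (hO z hne)
    simp [this]

theorem dirDeriv_iterate_shift (v : ℝ × ℝ) (ψ : ℝ × ℝ → ℝ) (y : ℝ × ℝ) (n : ℕ) :
    (dirDeriv v)^[n] (fun z => ψ (z + y)) = fun z => ((dirDeriv v)^[n] ψ) (z + y) := by
  induction n with
  | zero => rfl
  | succ n ih =>
    rw [Function.iterate_succ_apply', ih, Function.iterate_succ_apply']
    funext z
    simp only [dirDeriv]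
    rw [fderiv_comp_add_right]

/-! ### Consequences of the regularity of the solution -/

/-- First-order Taylor estimate for a Banach-valued curve: the mean value inequality is applied to
the derivative and then to the curve minus its linear part, hence no factor 1/2. -/
theorem norm_sub_sub_smul_derivWithin_le {E : Type*} [NormedAddCommGroup E] [NormedSpace ℝ E]
    {T M : ℝ} (hT : 0 < T) {V : ℝ → E} (hV : ContDiffOn ℝ 2 V (Icc 0 T))
    (hM : ∀ t ∈ Icc 0 T, ‖iteratedDerivWithin 2 V (Icc 0 T) t‖ ≤ M) {t t' : ℝ}
    (ht : t ∈ Icc 0 T) (ht' : t' ∈ Icc 0 T) (htt : t ≤ t') :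
    ‖V t' - V t - (t' - t) • derivWithin V (Icc 0 T) t‖ ≤ M * (t' - t) ^ 2 := by
  have hu := uniqueDiffOn_Icc hT
  have hM0 : 0 ≤ M := (norm_nonneg _).trans (hM t ht)
  have hsub : Icc t t' ⊆ Icc 0 T := Icc_subset_Icc ht.1 ht'.2
  have d1 : DifferentiableOn ℝ (derivWithin V (Icc 0 T)) (Icc 0 T) := by
    rw [← iteratedDerivWithin_one]
    exact hV.differentiableOn_iteratedDerivWithin (by norm_cast) hu
  have l1 : ∀ s ∈ Icc t t', ‖derivWithin V (Icc 0 T) s - derivWithin V (Icc 0 T) t‖ ≤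
      M * (t' - t) := by
    intro s hs
    have := (convex_Icc 0 T).norm_image_sub_le_of_norm_derivWithin_le d1
      (fun x hx => by
        have := hM x hx
        rwa [iteratedDerivWithin_succ, iteratedDerivWithin_one] at this) ht (hsub hs)
    refine this.trans ?_
    rw [Real.norm_of_nonneg (by linarith [hs.1])]
    gcongr
    exact hs.2
  have hd (s : ℝ) (hs : s ∈ Icc t t') :
      HasDerivWithinAt (fun s => V s - s • derivWithin V (Icc 0 T) t)
        (derivWithin V (Icc 0 T) s - derivWithin V (Icc 0 T) t) (Icc t t') s := by
    have h1 := (hV.differentiableOn (by norm_num) s (hsub hs)).hasDerivWithinAt.mono hsub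
    have h2 := ((hasDerivAt_id s).smul_const (derivWithin V (Icc 0 T) t)).hasDerivWithinAt
      (s := Icc t t')
    exact (h1.sub h2).congr_deriv (by simp)
  have := norm_image_sub_le_of_norm_deriv_le_segment' hd
    (fun s hs => l1 s (Ico_subset_Icc_self hs)) t' ⟨htt, le_rfl⟩
  calc _ = ‖(V t' - t' • derivWithin V (Icc 0 T) t) - (V t - t • derivWithin V (Icc 0 T) t)‖ := by
        congr 1; rw [sub_smul]; abel
    _ ≤ _ := this
    _ = _ := by ring

variable {Ω : Set (ℝ × ℝ)} {k : ℕ}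

/-- `weakD` as a continuous linear map. -/
def weakDCLM (Ω : Set (ℝ × ℝ)) (k p q : ℕ) (h : p + q ≤ k) : WInf Ω k →L[ℝ] LInf Ω :=
  (ContinuousLinearMap.proj
    (⟨(⟨p, by omega⟩, ⟨q, by omega⟩), h⟩ : MultiIdx k)).comp (WInf Ω k).subtypeL

theorem norm_weakD_le {p q : ℕ} (h : p + q ≤ k) (g : WInf Ω k) : ‖weakD g p q h‖ ≤ ‖g‖ :=
  norm_le_pi_norm g.1 _

theorem isWeakDeriv_weakD {p q : ℕ} (h : p + q ≤ k) (g : WInf Ω k) :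
    IsWeakDeriv Ω p q (weakD g 0 0 (Nat.zero_le k)) (weakD g p q h) :=
  g.2 ⟨(⟨p, by omega⟩, ⟨q, by omega⟩), h⟩

theorem Represents.integral_eq {T : ℝ} {V : ℝ → WInf Ω k} {u : ℝ → ℝ × ℝ → ℂ}
    (hV : Represents T V u) {t : ℝ} (ht : t ∈ Icc 0 T) (ψ : ℝ × ℝ → ℝ) :
    ∫ z in Ω, weakD (V t) 0 0 (Nat.zero_le k) z * (ψ z : ℂ) = ∫ z in Ω, u t z * (ψ z : ℂ) := by
  refine integral_congr_ae ?_
  filter_upwards [hV t ht] with z hz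
  rw [hz]

theorem Represents.integral_pderiv {T : ℝ} {V : ℝ → WInf Ω k} {u : ℝ → ℝ × ℝ → ℂ}
    (hV : Represents T V u) {t : ℝ} (ht : t ∈ Icc 0 T) {φ : ℝ × ℝ → ℝ} (hφ : IsTestFunction Ω φ)
    {p q : ℕ} (h : p + q ≤ k) (he : Even (p + q)) :
    ∫ z in Ω, u t z * (pderiv p q φ z : ℂ) = ∫ z in Ω, weakD (V t) p q h z * (φ z : ℂ) := by
  rw [← hV.integral_eq ht, isWeakDeriv_weakD h (V t) φ hφ, he.neg_one_pow, one_mul]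

theorem norm_le_of_ae_eq {O : Set (ℝ × ℝ)} (hO : IsOpen O) (hc : IsCompact (closure O))
    {R : ℝ × ℝ → ℂ} (hR : ContinuousOn R (closure O)) {g : LInf O}
    (hg : (g : ℝ × ℝ → ℂ) =ᵐ[volume.restrict O] R) : ∀ z ∈ closure O, ‖R z‖ ≤ ‖g‖ := by
  refine norm_le_of_forall_test hO hc hR fun φ hφ hφ0 => ?_
  have h1 := norm_testPairing_le hφ.1 hφ.2.1 g
  simp only [abs_of_nonneg (hφ0 _)] at h1
  refine (le_of_eq (congrArg norm (integral_congr_ae ?_))).trans h1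
  filter_upwards [hg] with z hz
  rw [hz]

theorem Represents.norm_le {T : ℝ} {V : ℝ → WInf Ω k} {u : ℝ → ℝ × ℝ → ℂ}
    (hV : Represents T V u) (hO : IsOpen Ω) (hc : IsCompact (closure Ω))
    (hu : ∀ t ∈ Icc 0 T, ContinuousOn (u t) (closure Ω)) {t : ℝ} (ht : t ∈ Icc 0 T)
    {z : ℝ × ℝ} (hz : z ∈ closure Ω) : ‖u t z‖ ≤ ‖V t‖ :=
  (norm_le_of_ae_eq hO hc (hu t ht) (hV t ht) z hz).trans (norm_weakD_le _ _)

theorem Represents.norm_sub_le {T : ℝ} {V : ℝ → WInf Ω k} {u : ℝ → ℝ × ℝ → ℂ}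
    (hV : Represents T V u) (hO : IsOpen Ω) (hc : IsCompact (closure Ω))
    (hu : ∀ t ∈ Icc 0 T, ContinuousOn (u t) (closure Ω)) {t s : ℝ} (ht : t ∈ Icc 0 T)
    (hs : s ∈ Icc 0 T) {z : ℝ × ℝ} (hz : z ∈ closure Ω) : ‖u t z - u s z‖ ≤ ‖V t - V s‖ := by
  refine (norm_le_of_ae_eq (R := fun z => u t z - u s z)
    (g := weakD (V t - V s) 0 0 (Nat.zero_le k)) hO hc ((hu t ht).sub (hu s hs)) ?_ z hz).trans
    (norm_weakD_le _ _)
  have e : weakD (V t - V s) 0 0 (Nat.zero_le k) =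
    weakD (V t) 0 0 (Nat.zero_le k) - weakD (V s) 0 0 (Nat.zero_le k) := rfl
  rw [e]
  filter_upwards [Lp.coeFn_sub (weakD (V t) 0 0 (Nat.zero_le k)) (weakD (V s) 0 0 (Nat.zero_le k)),
    hV t ht, hV s hs] with z h1 h2 h3
  rw [h1, Pi.sub_apply, h2, h3]

/-- An element of `WInf Ω 0` is determined by its function. This identifies the time derivative in
the equation with that of the C² curve from the regularity hypothesis. -/
theorem Represents.eqOn {T : ℝ} {V W : ℝ → WInf Ω 0} {u : ℝ → ℝ × ℝ → ℂ}
    (hV : Represents T V u) (hW : Represents T W u) : EqOn V W (Icc 0 T) := by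
  intro t ht
  refine Subtype.ext (funext fun α => Lp.ext ?_)
  have hα : α = zeroIdx 0 := Subtype.ext (Prod.ext (Subsingleton.elim (α := Fin 1) _ _)
    (Subsingleton.elim (α := Fin 1) _ _))
  rw [hα]
  exact (hV t ht).trans (hW t ht).symm

/-- The equation at every time of `[0,T]`, tested with `φ`. -/
theorem IsSolution.integral_equation {T lam : ℝ} (hT : 0 < T) {u₀ : ℝ × ℝ → ℂ}
    {u : ℝ → ℝ × ℝ → ℂ} (hO : IsOpen Ω) (hc : IsCompact (closure Ω))
    (hu : IsSolution Ω T lam u₀ u) {V : ℝ → WInf Ω 0} (hV : Represents T V u)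
    {φ : ℝ × ℝ → ℝ} (hφ : IsTestFunction Ω φ) {t : ℝ} (ht : t ∈ Icc 0 T) :
    Complex.I * testPairing Ω hφ.1 hφ.2.1 (weakD (derivWithin V (Icc 0 T) t) 0 0 le_rfl) +
      ((∫ z in Ω, u t z * (pderiv 2 0 φ z : ℂ)) + ∫ z in Ω, u t z * (pderiv 0 2 φ z : ℂ)) =
    2 * lam * ∫ z in Ω, f (u t z) * (φ z : ℂ) := by
  obtain ⟨P, Q, hP, hPd, hQ, hQd, heq⟩ := hu.equation
  have hPV : derivWithin V (Icc 0 T) t = derivWithin P (Icc 0 T) t :=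
    derivWithin_congr (hV.eqOn hP) (hV.eqOn hP ht)
  rw [hPV, hQ.integral_pderiv ht hφ (p := 2) (q := 0) le_rfl (by decide),
    hQ.integral_pderiv ht hφ (p := 0) (q := 2) le_rfl (by decide)]
  set L := testPairing Ω hφ.1 hφ.2.1 with hL
  have hPc : ContinuousOn (derivWithin P (Icc 0 T)) (Icc 0 T) :=
    hPd.continuousOn_derivWithin (uniqueDiffOn_Icc hT) le_rfl
  have hQc : ContinuousOn Q (Icc 0 T) := hQd.continuousOn
  have hPc0 : ContinuousOn P (Icc 0 T) := hPd.continuousOn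
  have c1 : ContinuousOn (fun t => Complex.I * L (weakD (derivWithin P (Icc 0 T) t) 0 0 le_rfl) +
      (L (weakD (Q t) 2 0 le_rfl) + L (weakD (Q t) 0 2 le_rfl))) (Icc 0 T) := by
    refine (continuousOn_const.mul ?_).add (ContinuousOn.add ?_ ?_)
    · exact (L.comp (weakDCLM Ω 0 0 0 le_rfl)).continuous.comp_continuousOn hPc
    · exact (L.comp (weakDCLM Ω 2 2 0 le_rfl)).continuous.comp_continuousOn hQc
    · exact (L.comp (weakDCLM Ω 2 0 2 le_rfl)).continuous.comp_continuousOn hQc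
  -- Dominated convergence: `u` is uniformly bounded, and at each point of `Ω` it is continuous in
  -- time because its increments are bounded by those of `P`.
  have c2 : ContinuousOn (fun t => 2 * lam * ∫ z in Ω, f (u t z) * (φ z : ℂ)) (Icc 0 T) := by
    refine continuousOn_const.mul ?_
    obtain ⟨B, hB⟩ := isCompact_Icc.exists_bound_of_continuousOn hPc0
    obtain ⟨C, hC⟩ := (isCompact_closedBall (0 : ℂ) B).exists_bound_of_continuousOn
      continuous_f.continuousOn
    have hφi : Integrable φ := hφ.1.continuous.integrable_of_hasCompactSupport hφ.2.1
    refine continuousOn_of_dominated (bound := fun z => C * |φ z|) ?_ ?_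
      (hφi.abs.const_mul C).restrict ?_
    · intro t ht
      refine AEStronglyMeasurable.mul ?_
        (Complex.continuous_ofReal.comp hφ.1.continuous).aestronglyMeasurable
      exact continuous_f.comp_aestronglyMeasurable
        ((Lp.aestronglyMeasurable _).congr (hP t ht))
    · intro t ht
      filter_upwards [ae_restrict_mem hO.measurableSet] with z hz
      rw [norm_mul, Complex.norm_real, Real.norm_eq_abs]
      gcongr
      refine hC _ (mem_closedBall_zero_iff.2 ?_)
      exact (hP.norm_le hO hc hu.continuousOn ht (subset_closure hz)).trans (hB t ht)
    · filter_upwards [ae_restrict_mem hO.measurableSet] with z hz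
      refine ContinuousOn.mul (continuous_f.comp_continuousOn ?_) continuousOn_const
      intro s hs
      refine tendsto_iff_norm_sub_tendsto_zero.2 ?_
      refine squeeze_zero' (Filter.Eventually.of_forall fun _ => norm_nonneg _) ?_
        (tendsto_iff_norm_sub_tendsto_zero.1 (hPc0 s hs))
      filter_upwards [self_mem_nhdsWithin] with r hr
      exact hP.norm_sub_le hO hc hu.continuousOn hr hs (subset_closure hz)
  have e : EqOn (fun t => Complex.I * L (weakD (derivWithin P (Icc 0 T) t) 0 0 le_rfl) +
      (L (weakD (Q t) 2 0 le_rfl) + L (weakD (Q t) 0 2 le_rfl)))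
      (fun t => 2 * lam * ∫ z in Ω, f (u t z) * (φ z : ℂ)) (Ioc 0 T) := by
    intro t ht
    simp only [hL, testPairing_apply]
    have i1 (g : LInf Ω) := integrable_mul_test g hφ.1 hφ.2.1
    rw [← integral_add' (i1 _) (i1 _), ← integral_const_mul, ← integral_const_mul,
      ← integral_add' ((i1 _).const_mul _) ((i1 _).add (i1 _))]
    refine integral_congr_ae ?_
    filter_upwards [heq t ht] with z hz
    have : ((Real.log (‖u t z‖ ^ 2) : ℝ) : ℂ) = 2 * (Real.log ‖u t z‖ : ℂ) := by
      rw [Real.log_pow]; push_cast; ring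
    rw [this] at hz
    simp only [f, Pi.add_apply]
    linear_combination (φ z : ℂ) * hz
  -- The equation is assumed only for `t > 0`; density of `Ioc 0 T` and continuity extend it to `t =
  -- 0`, which the first time step requires.
  exact e.of_subset_closure c1 c2 Ioc_subset_Icc_self (by rw [closure_Ioc hT.ne]) ht

theorem IsTestFunction.shift {O : Set (ℝ × ℝ)} {φ : ℝ × ℝ → ℝ} (hφ : IsTestFunction O φ)
    (y : ℝ × ℝ) (h : ∀ z, z + y ∈ O → z ∈ Ω) : IsTestFunction Ω (fun z => φ (z + y)) := by
  refine ⟨hφ.1.comp (contDiff_id.add contDiff_const),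
    hφ.2.1.comp_homeomorph (Homeomorph.addRight y), fun z hz => h z (hφ.2.2 ?_)⟩
  have := tsupport_comp_eq_preimage φ (Homeomorph.addRight y)
  exact this.subset hz

/-! ### The local truncation error -/

theorem integral_sum_mul_test {O : Set (ℝ × ℝ)} (hc : IsCompact (closure O)) {φ : ℝ × ℝ → ℝ}
    (hφ : Continuous φ) {ι : Type*} [Fintype ι] (α : ι → ℂ) (g : ι → ℝ × ℝ → ℂ)
    (hg : ∀ i, ContinuousOn (g i) (closure O)) :
    ∫ z in O, (∑ i, α i * g i z) * (φ z : ℂ) = ∑ i, α i * ∫ z in O, g i z * (φ z : ℂ) := by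
  have hI (i : ι) : Integrable (fun z => α i * (g i z * (φ z : ℂ))) (volume.restrict O) :=
    ((((hg i).mul (Complex.continuous_ofReal.comp hφ).continuousOn).integrableOn_compact
      hc).mono_set subset_closure).const_mul _
  simp only [← integral_const_mul]
  rw [← integral_finsetSum _ fun i _ => hI i]
  simp only [Finset.sum_mul, mul_assoc]

theorem isOpen_rect (a b c d : ℝ) : IsOpen (rect a b c d) := isOpen_Ioo.prod isOpen_Ioo

theorem closure_rect {a b c d : ℝ} (hab : a < b) (hcd : c < d) :
    closure (rect a b c d) = Icc a b ×ˢ Icc c d := by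
  rw [rect, closure_prod_eq, closure_Ioo hab.ne, closure_Ioo hcd.ne]

theorem isCompact_closure_rect {a b c d : ℝ} (hab : a < b) (hcd : c < d) :
    IsCompact (closure (rect a b c d)) := by
  rw [closure_rect hab hcd]; exact isCompact_Icc.prod isCompact_Icc

/-- Here the shifts sit on `u` and the integrals run over the smaller set `O`. By `hO`, shifts of
length at most `h` keep the support of the test function inside `Ω`, where the weak derivative
identity is available. -/
theorem norm_secondDifference_test_le {Ω O : Set (ℝ × ℝ)} [IsFiniteMeasure (volume.restrict Ω)]
    {g w : LInf Ω} {φ : ℝ × ℝ → ℝ} (hφ : IsTestFunction O φ) (v : ℝ × ℝ) {h : ℝ} (hh : 0 ≤ h)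
    (hO : ∀ s ∈ Icc (-h) h, ∀ z, z + s • v ∈ O → z ∈ Ω)
    (hgw : ∀ ψ, IsTestFunction Ω ψ →
      ∫ z in Ω, g z * ((dirDeriv v)^[4] ψ z : ℂ) = ∫ z in Ω, w z * (ψ z : ℂ)) {u : ℝ × ℝ → ℂ}
    (hu : (g : ℝ × ℝ → ℂ) =ᵐ[volume.restrict Ω] u) :
    ‖(∫ z in O, u (z + h • v) * (φ z : ℂ)) - 2 * (∫ z in O, u z * (φ z : ℂ)) +
      (∫ z in O, u (z + (-h) • v) * (φ z : ℂ)) -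
      h ^ 2 * ∫ z in Ω, u z * ((dirDeriv v)^[2] φ z : ℂ)‖ ≤
      2 * (‖w‖ * ∫ z, |φ z|) * h ^ 4 := by
  have key := norm_secondDifference_integral_sub_le g w hφ.1 hφ.2.1 v hh fun s hs => by
    have := hgw _ (hφ.shift (s • v) (hO s hs))
    rwa [dirDeriv_iterate_shift] at this
  have e (ψ : ℝ × ℝ → ℝ) : ∫ z in Ω, g z * (ψ z : ℂ) = ∫ z in Ω, u z * (ψ z : ℂ) := by
    refine integral_congr_ae ?_
    filter_upwards [hu] with z hz
    rw [hz]
  have sh (s : ℝ) (hs : s ∈ Icc (-h) h) : ∫ z in O, u (z + s • v) * (φ z : ℂ) =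
      ∫ z in Ω, u z * (φ (z + (-s) • v) : ℂ) := by
    rw [setIntegral_shift (Ω := Ω) u (s • v) fun z hz => hφ.2.2 (subset_tsupport _ hz)]
    · simp [sub_eq_add_neg]
    · intro z hz
      refine hO (-s) ⟨by linarith [hs.2], by linarith [hs.1]⟩ z (hφ.2.2 (subset_tsupport _ ?_))
      simpa [sub_eq_add_neg] using hz
  have s0 := sh 0 ⟨by linarith, hh⟩
  simp only [zero_smul, add_zero, neg_zero] at s0
  rw [sh h ⟨by linarith, le_rfl⟩, sh (-h) ⟨le_rfl, by linarith⟩, s0, neg_neg]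
  simp only [e] at key
  refine le_trans (le_of_eq ?_) key
  congr 1
  ring

theorem weakD_sub {Ω : Set (ℝ × ℝ)} {k p q : ℕ} (h : p + q ≤ k) (g g' : WInf Ω k) :
    weakD (g - g') p q h = weakD g p q h - weakD g' p q h := rfl

theorem weakD_smul {Ω : Set (ℝ × ℝ)} {k p q : ℕ} (h : p + q ≤ k) (r : ℝ) (g : WInf Ω k) :
    weakD (r • g) p q h = r • weakD g p q h := rfl

/-- The tested residual is a sum of five remainders: Taylor in time, Taylor in each space direction,
and the change of each second derivative between the two time levels. The last two appear because
the Laplacian is taken at the new time and the nonlinearity at the old one. -/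
theorem truncation_arith {D hx hy M I₀ lam : ℝ} {U U' P Ux Uy U'x U'y Xp Xm Yp Ym Fu : ℂ}
    (hD : 0 < D) (hhx : 0 < hx) (hhy : 0 < hy)
    (b0 : ‖U' - U - (D : ℂ) * P‖ ≤ M * D ^ 2 * I₀)
    (bx : ‖Xp - 2 * U' + Xm - (hx : ℂ) ^ 2 * U'x‖ ≤ 2 * (M * I₀) * hx ^ 4)
    (bY : ‖Yp - 2 * U' + Ym - (hy : ℂ) ^ 2 * U'y‖ ≤ 2 * (M * I₀) * hy ^ 4)
    (b2x : ‖U'x - Ux‖ ≤ M * D * I₀) (b2y : ‖U'y - Uy‖ ≤ M * D * I₀)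
    (heq : Complex.I * P + (Ux + Uy) = 2 * lam * Fu) :
    ‖(Complex.I / (D : ℂ) - 2 / (hx : ℂ) ^ 2 - 2 / (hy : ℂ) ^ 2) * U' +
      -(Complex.I / (D : ℂ)) * U + 1 / (hx : ℂ) ^ 2 * Xp + 1 / (hx : ℂ) ^ 2 * Xm +
      1 / (hy : ℂ) ^ 2 * Yp + 1 / (hy : ℂ) ^ 2 * Ym + -(2 * lam) * Fu‖ ≤
      M * (3 * D + 2 * hx ^ 2 + 2 * hy ^ 2) * I₀ := by
  have hDc : (D : ℂ) ≠ 0 := by exact_mod_cast hD.ne'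
  have hxc : (hx : ℂ) ≠ 0 := by exact_mod_cast hhx.ne'
  have hyc : (hy : ℂ) ≠ 0 := by exact_mod_cast hhy.ne'
  have nD : ‖(D : ℂ)‖ = D := by rw [Complex.norm_real, Real.norm_of_nonneg hD.le]
  have nx : ‖(hx : ℂ)‖ = hx := by rw [Complex.norm_real, Real.norm_of_nonneg hhx.le]
  have ny : ‖(hy : ℂ)‖ = hy := by rw [Complex.norm_real, Real.norm_of_nonneg hhy.le]
  calc _ = ‖Complex.I / (D : ℂ) * (U' - U - (D : ℂ) * P) +
        1 / (hx : ℂ) ^ 2 * (Xp - 2 * U' + Xm - (hx : ℂ) ^ 2 * U'x) +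
        1 / (hy : ℂ) ^ 2 * (Yp - 2 * U' + Ym - (hy : ℂ) ^ 2 * U'y) +
        (U'x - Ux) + (U'y - Uy)‖ := by
        congr 1
        field_simp
        linear_combination ((D : ℂ) * (hx : ℂ) ^ 2 * (hy : ℂ) ^ 2) * heq
    _ ≤ 1 / D * (M * D ^ 2 * I₀) + 1 / hx ^ 2 * (2 * (M * I₀) * hx ^ 4) +
        1 / hy ^ 2 * (2 * (M * I₀) * hy ^ 4) + M * D * I₀ + M * D * I₀ := by
        refine norm_add_le_of_le (norm_add_le_of_le (norm_add_le_of_le (norm_add_le_of_le ?_ ?_)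
          ?_) b2x) b2y
        all_goals
          simp only [norm_mul, norm_div, norm_pow, nD, nx, ny, Complex.norm_I, norm_one]
          gcongr
    _ = _ := by field_simp; ring

theorem norm_integral_sub_sub_le {Ω : Set (ℝ × ℝ)} {T M : ℝ} (hT : 0 < T) {V : ℝ → WInf Ω 0}
    {u : ℝ → ℝ × ℝ → ℂ} (hV : Represents T V u) (hVd : ContDiffOn ℝ 2 V (Icc 0 T))
    (hM : ∀ t ∈ Icc 0 T, ‖iteratedDerivWithin 2 V (Icc 0 T) t‖ ≤ M) {t t' : ℝ}
    (ht : t ∈ Icc 0 T) (ht' : t' ∈ Icc 0 T) (htt : t ≤ t') {φ : ℝ × ℝ → ℝ}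
    (hφ : IsTestFunction Ω φ) :
    ‖(∫ z in Ω, u t' z * (φ z : ℂ)) - (∫ z in Ω, u t z * (φ z : ℂ)) -
      ((t' - t : ℝ) : ℂ) *
        testPairing Ω hφ.1 hφ.2.1 (weakD (derivWithin V (Icc 0 T) t) 0 0 le_rfl)‖ ≤
      M * (t' - t) ^ 2 * ∫ z, |φ z| := by
  rw [← hV.integral_eq ht', ← hV.integral_eq ht, ← testPairing_apply hφ.1 hφ.2.1,
    ← testPairing_apply hφ.1 hφ.2.1, ← Complex.real_smul, ← ContinuousLinearMap.map_smul,
    ← ContinuousLinearMap.map_sub, ← ContinuousLinearMap.map_sub, ← weakD_smul, ← weakD_sub,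
    ← weakD_sub]
  have h1 := norm_sub_sub_smul_derivWithin_le hT hVd hM ht ht' htt
  generalize V t' - V t - (t' - t) • derivWithin V (Icc 0 T) t = w at h1 ⊢
  exact (norm_testPairing_le hφ.1 hφ.2.1 _).trans (mul_le_mul_of_nonneg_right
    ((norm_weakD_le _ w).trans h1) (integral_nonneg fun _ => abs_nonneg _))

theorem norm_integral_pderiv_sub_le {Ω : Set (ℝ × ℝ)} {k : ℕ} {T M : ℝ}
    {W : ℝ → WInf Ω k} {u : ℝ → ℝ × ℝ → ℂ} (hW : Represents T W u)
    (hWd : ContDiffOn ℝ 1 W (Icc 0 T))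
    (hM : ∀ t ∈ Icc 0 T, ‖iteratedDerivWithin 1 W (Icc 0 T) t‖ ≤ M) {t t' : ℝ}
    (ht : t ∈ Icc 0 T) (ht' : t' ∈ Icc 0 T) (htt : t ≤ t') {φ : ℝ × ℝ → ℝ}
    (hφ : IsTestFunction Ω φ) {p q : ℕ} (h : p + q ≤ k) (he : Even (p + q)) :
    ‖(∫ z in Ω, u t' z * (pderiv p q φ z : ℂ)) - ∫ z in Ω, u t z * (pderiv p q φ z : ℂ)‖ ≤
      M * (t' - t) * ∫ z, |φ z| := by
  rw [hW.integral_pderiv ht' hφ h he, hW.integral_pderiv ht hφ h he,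
    ← testPairing_apply hφ.1 hφ.2.1, ← testPairing_apply hφ.1 hφ.2.1,
    ← ContinuousLinearMap.map_sub, ← weakD_sub]
  refine (norm_testPairing_le hφ.1 hφ.2.1 _).trans ?_
  gcongr
  refine (norm_weakD_le h _).trans ?_
  have := (convex_Icc 0 T).norm_image_sub_le_of_norm_derivWithin_le
    (hWd.differentiableOn (by norm_num))
    (fun x hx => by simpa [iteratedDerivWithin_one] using hM x hx) ht ht'
  rwa [Real.norm_of_nonneg (sub_nonneg.2 htt)] at this

/-- The residual is continuous on the closure of the rectangle `O` shrunk by one mesh width on each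
side, so it can be bounded pointwise by testing. The conditions `hx3` and `hy3` keep `O` nonempty;
interior grid points may lie on its boundary, which is why the bound is needed on the closure. -/
theorem truncation_error_le {a b c d T lam M hx hy t t' : ℝ} (hab : a < b) (hcd : c < d)
    (hT : 0 < T) {u₀ : ℝ × ℝ → ℂ} {u : ℝ → ℝ × ℝ → ℂ}
    (hu : IsSolution (rect a b c d) T lam u₀ u)
    (hu20 : InCWWithBound (rect a b c d) T 2 0 M u)
    (hu12 : InCWWithBound (rect a b c d) T 1 2 M u)
    (hu04 : InCWWithBound (rect a b c d) T 0 4 M u)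
    (hhx : 0 < hx) (hhy : 0 < hy) (hx3 : 3 * hx ≤ b - a) (hy3 : 3 * hy ≤ d - c)
    (ht : t ∈ Icc 0 T) (ht' : t' ∈ Icc 0 T) (htt : t < t') {x y : ℝ}
    (hxm : x ∈ Icc (a + hx) (b - hx)) (hym : y ∈ Icc (c + hy) (d - hy)) :
    ‖Complex.I * ((u t' (x, y) - u t (x, y)) / ((t' - t : ℝ) : ℂ)) +
      ((u t' (x + hx, y) - 2 * u t' (x, y) + u t' (x - hx, y)) / (hx : ℂ) ^ 2 +
        (u t' (x, y + hy) - 2 * u t' (x, y) + u t' (x, y - hy)) / (hy : ℂ) ^ 2) -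
      2 * lam * f (u t (x, y))‖ ≤ M * (3 * (t' - t) + 2 * hx ^ 2 + 2 * hy ^ 2) := by
  set Ω := rect a b c d with hΩ
  obtain ⟨V, hV, hVd, hVb⟩ := hu20
  obtain ⟨W, hW, hWd, hWb⟩ := hu12
  obtain ⟨Z, hZ, -, hZb⟩ := hu04
  set O := rect (a + hx) (b - hx) (c + hy) (d - hy) with hO
  have hab' : a + hx < b - hx := by linarith
  have hcd' : c + hy < d - hy := by linarith
  have hΩo : IsOpen Ω := isOpen_rect _ _ _ _
  have hOo : IsOpen O := isOpen_rect _ _ _ _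
  have hΩc : IsCompact (closure Ω) := isCompact_closure_rect hab hcd
  have hOc : IsCompact (closure O) := isCompact_closure_rect hab' hcd'
  have hfin : IsFiniteMeasure (volume.restrict Ω) :=
    isFiniteMeasure_restrict.2 ((measure_mono subset_closure).trans_lt hΩc.measure_lt_top).ne
  have hD : 0 < t' - t := sub_pos.2 htt
  have hM : 0 ≤ M := (norm_nonneg _).trans (hZb 0 le_rfl t ht)
  have hOΩ : ∀ z, z ∈ O → z ∈ Ω := by
    rintro z ⟨⟨h1, h2⟩, h3, h4⟩
    refine ⟨⟨?_, ?_⟩, ?_, ?_⟩ <;> linarith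
  have mem_closure {s r : ℝ} (hs : |s| ≤ hx) (hr : |r| ≤ hy) (z : ℝ × ℝ) (hz : z ∈ closure O) :
      z + (s, r) ∈ closure Ω := by
    rw [hO, closure_rect hab' hcd'] at hz
    rw [hΩ, closure_rect hab hcd]
    obtain ⟨⟨h1, h2⟩, h3, h4⟩ := hz
    rw [abs_le] at hs hr
    refine ⟨⟨?_, ?_⟩, ?_, ?_⟩ <;> simp <;> linarith
  have cont {τ : ℝ} (hτ : τ ∈ Icc 0 T) {s r : ℝ} (hs : |s| ≤ hx) (hr : |r| ≤ hy) :
      ContinuousOn (fun z => u τ (z + (s, r))) (closure O) :=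
    (hu.continuousOn τ hτ).comp (continuous_id.add continuous_const).continuousOn
      (mem_closure hs hr)
  -- The residual written as a linear combination of seven continuous functions, so that the
  -- integral can be distributed over them.
  set α : Fin 7 → ℂ := ![Complex.I / ((t' - t : ℝ) : ℂ) - 2 / (hx : ℂ) ^ 2 - 2 / (hy : ℂ) ^ 2,
    -(Complex.I / ((t' - t : ℝ) : ℂ)), 1 / (hx : ℂ) ^ 2, 1 / (hx : ℂ) ^ 2, 1 / (hy : ℂ) ^ 2,
    1 / (hy : ℂ) ^ 2, -(2 * lam)] with hα
  set g : Fin 7 → ℝ × ℝ → ℂ := ![fun z => u t' z, fun z => u t z,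
    fun z => u t' (z + hx • ((1 : ℝ), (0 : ℝ))), fun z => u t' (z + (-hx) • ((1 : ℝ), (0 : ℝ))),
    fun z => u t' (z + hy • ((0 : ℝ), (1 : ℝ))), fun z => u t' (z + (-hy) • ((0 : ℝ), (1 : ℝ))),
    fun z => f (u t z)] with hg
  have cg : ∀ i, ContinuousOn (g i) (closure O) := by
    have ax : |hx| ≤ hx := (abs_of_pos hhx).le
    have ay : |hy| ≤ hy := (abs_of_pos hhy).le
    have c0 {τ : ℝ} (hτ : τ ∈ Icc 0 T) : ContinuousOn (fun z => u τ z) (closure O) :=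
      (hu.continuousOn τ hτ).mono (closure_mono hOΩ)
    simp only [Fin.forall_fin_succ, hg]
    refine ⟨c0 ht', c0 ht, ?_, ?_, ?_, ?_, continuous_f.comp_continuousOn (c0 ht), fun i => i.elim0⟩
    · simpa using cont ht' (s := hx) (r := 0) ax (by simpa using hhy.le)
    · simpa using cont ht' (s := -hx) (r := 0) (by simpa using ax) (by simpa using hhy.le)
    · simpa using cont ht' (s := 0) (r := hy) (by simpa using hhx.le) ay
    · simpa using cont ht' (s := 0) (r := -hy) (by simpa using hhx.le) (by simpa using ay)
  have main := norm_le_of_forall_test hOo hOc (R := fun z => ∑ i, α i * g i z)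
    (B := M * (3 * (t' - t) + 2 * hx ^ 2 + 2 * hy ^ 2))
    (continuousOn_finsetSum _ fun i _ => continuousOn_const.mul (cg i)) ?_ (x, y)
    (by rw [hO, closure_rect hab' hcd']; exact ⟨hxm, hym⟩)
  · refine le_trans (le_of_eq (congrArg norm ?_)) main
    simp only [Fin.sum_univ_seven, hα, hg]
    simp [← sub_eq_add_neg]
    ring
  intro φ hφ hφ0
  have hφΩ : IsTestFunction Ω φ := ⟨hφ.1, hφ.2.1, fun z hz => hOΩ z (hφ.2.2 hz)⟩
  have sub_int (F : ℝ × ℝ → ℂ) : ∫ z in O, F z * (φ z : ℂ) = ∫ z in Ω, F z * (φ z : ℂ) := by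
    have h1 : ∀ z, φ z ≠ 0 → z ∈ O := fun z hz => hφ.2.2 (subset_tsupport _ hz)
    simpa using setIntegral_shift F 0 h1 fun z hz => hOΩ z (h1 z (by simpa using hz))
  set I₀ := ∫ z, φ z with hI₀
  have hI₀0 : 0 ≤ I₀ := integral_nonneg hφ0
  have habs : ∫ z, |φ z| = I₀ := by simp only [abs_of_nonneg (hφ0 _), hI₀]
  have heq := hu.integral_equation hT hΩo hΩc hV hφΩ ht
  have bx := norm_secondDifference_test_le (w := weakD (Z t') 4 0 le_rfl) hφ (1, 0) hhx.le
    (fun s hs z hz => by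
      obtain ⟨⟨h1, h2⟩, h3, h4⟩ := hz
      simp at h1 h2 h3 h4
      refine ⟨⟨?_, ?_⟩, ?_, ?_⟩ <;> linarith [hs.1, hs.2])
    (fun ψ hψ => (isWeakDeriv_weakD (p := 4) (q := 0) le_rfl (Z t') ψ hψ).trans (by norm_num))
    (hZ t' ht')
  have bY := norm_secondDifference_test_le (w := weakD (Z t') 0 4 le_rfl) hφ (0, 1) hhy.le
    (fun s hs z hz => by
      obtain ⟨⟨h1, h2⟩, h3, h4⟩ := hz
      simp at h1 h2 h3 h4
      refine ⟨⟨?_, ?_⟩, ?_, ?_⟩ <;> linarith [hs.1, hs.2])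
    (fun ψ hψ => (isWeakDeriv_weakD (p := 0) (q := 4) le_rfl (Z t') ψ hψ).trans (by norm_num))
    (hZ t' ht')
  have b4 {p q : ℕ} (h : p + q ≤ 4) : ‖weakD (Z t') p q h‖ ≤ M :=
    (norm_weakD_le h _).trans (by simpa using hZb 0 le_rfl t' ht')
  rw [habs] at bx bY
  have b2x := norm_integral_pderiv_sub_le hW hWd (hWb 1 le_rfl) ht ht' htt.le hφΩ (p := 2)
    (q := 0) le_rfl (by decide)
  have b2y := norm_integral_pderiv_sub_le hW hWd (hWb 1 le_rfl) ht ht' htt.le hφΩ (p := 0)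
    (q := 2) le_rfl (by decide)
  have b0 := norm_integral_sub_sub_le hT hV hVd (hVb 2 le_rfl) ht ht' htt.le hφΩ
  rw [habs] at b2x b2y b0
  rw [integral_sum_mul_test hOc hφ.1.continuous α g cg]
  simp only [Fin.sum_univ_seven, hα, hg]
  simp only [Matrix.cons_val]
  rw [sub_int (fun z => f (u t z)), sub_int (fun z => u t z), sub_int (fun z => u t' z)]
  rw [sub_int (fun z => u t' z)] at bx bY
  -- The twice iterated directional derivative along a coordinate axis is by definition the
  -- corresponding `pderiv`.
  change ‖_ - _ + _ - (hx : ℂ) ^ 2 * ∫ z in Ω, u t' z * (pderiv 2 0 φ z : ℂ)‖ ≤ _ at bx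
  change ‖_ - _ + _ - (hy : ℂ) ^ 2 * ∫ z in Ω, u t' z * (pderiv 0 2 φ z : ℂ)‖ ≤ _ at bY
  generalize (∫ z in Ω, u t' z * (pderiv 2 0 φ z : ℂ)) = U'x at *
  generalize (∫ z in Ω, u t' z * (pderiv 0 2 φ z : ℂ)) = U'y at *
  generalize (∫ z in Ω, u t z * (pderiv 2 0 φ z : ℂ)) = Ux at *
  generalize (∫ z in Ω, u t z * (pderiv 0 2 φ z : ℂ)) = Uy at *
  generalize (∫ z in Ω, u t' z * (φ z : ℂ)) = U' at *
  generalize (∫ z in Ω, u t z * (φ z : ℂ)) = U at *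
  generalize (∫ z in Ω, f (u t z) * (φ z : ℂ)) = Fu at *
  generalize (∫ z in O, u t' (z + hx • ((1 : ℝ), (0 : ℝ))) * (φ z : ℂ)) = Xp at *
  generalize (∫ z in O, u t' (z + (-hx) • ((1 : ℝ), (0 : ℝ))) * (φ z : ℂ)) = Xm at *
  generalize (∫ z in O, u t' (z + hy • ((0 : ℝ), (1 : ℝ))) * (φ z : ℂ)) = Yp at *
  generalize (∫ z in O, u t' (z + (-hy) • ((0 : ℝ), (1 : ℝ))) * (φ z : ℂ)) = Ym at *
  generalize testPairing Ω hφΩ.1 hφΩ.2.1 (weakD (derivWithin V (Icc 0 T) t) 0 0 le_rfl) = P at *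
  refine truncation_arith hD hhx hhy b0 (bx.trans ?_) (bY.trans ?_) b2x b2y heq
  · have := b4 (p := 4) (q := 0) le_rfl
    gcongr
  · have := b4 (p := 0) (q := 4) le_rfl
    gcongr

/-! ### The error equation -/

/-- The extra factor `τ` turns the non-Lipschitz linear term into quadratic ones: `16 * (τ * e) ≤ 8
* (e ^ 2 + τ ^ 2)`. Adding this 8 to the quadratic coefficient `2 + 2 * (1 + M) ^ 2` gives the
constant. -/
theorem norm_f_sub_sq_mul_le {M τ : ℝ} (hτ : 0 < τ) (hτ1 : τ ≤ 1) {z w : ℂ} (hz : ‖z‖ ≤ M) :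
    τ * ‖f z - f w‖ ^ 2 ≤
      (10 + 2 * (1 + M) ^ 2) * (‖z - w‖ ^ 2 + τ ^ 2 + τ * ‖z - w‖ ^ 4) := by
  have h := norm_f_sub_sq_le (w := w) hz
  set e := ‖z - w‖
  have he : 0 ≤ e := norm_nonneg _
  have hM2 : 0 ≤ (1 + M) ^ 2 := sq_nonneg _
  calc τ * ‖f z - f w‖ ^ 2 ≤ τ * (16 * e + (2 + 2 * (1 + M) ^ 2) * e ^ 2 + 2 * e ^ 4) := by gcongr
    _ = 16 * (τ * e) + (2 + 2 * (1 + M) ^ 2) * (τ * e ^ 2) + 2 * (τ * e ^ 4) := by ring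
    _ ≤ 8 * (e ^ 2 + τ ^ 2) + (2 + 2 * (1 + M) ^ 2) * e ^ 2 +
        (10 + 2 * (1 + M) ^ 2) * (τ * e ^ 4) := by
      have h1 : 16 * (τ * e) ≤ 8 * (e ^ 2 + τ ^ 2) := by nlinarith [sq_nonneg (τ - e)]
      have h2 : τ * e ^ 2 ≤ e ^ 2 := mul_le_of_le_one_left (sq_nonneg _) hτ1
      have h3 : (2 : ℝ) ≤ 10 + 2 * (1 + M) ^ 2 := by linarith
      gcongr
    _ ≤ _ := by nlinarith [sq_nonneg τ]

theorem gridPoint_mem_closure {a b c d : ℝ} (hab : a < b) (hcd : c < d) {J K j k : ℕ} {hx hy : ℝ}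
    (hhx : 0 < hx) (hhy : 0 < hy) (hJ : J * hx = b - a) (hK : K * hy = d - c) (hj : j ≤ J)
    (hk : k ≤ K) : (a + j * hx, c + k * hy) ∈ closure (rect a b c d) := by
  rw [closure_rect hab hcd]
  have h1 : (j : ℝ) * hx ≤ J * hx := by gcongr
  have h2 : (k : ℝ) * hy ≤ K * hy := by gcongr
  have h3 : 0 ≤ (j : ℝ) * hx := by positivity
  have h4 : 0 ≤ (k : ℝ) * hy := by positivity
  refine ⟨⟨?_, ?_⟩, ?_, ?_⟩ <;> simp <;> linarith

theorem gridPoint_mem_frontier {a b c d : ℝ} (hab : a < b) (hcd : c < d) {J K j k : ℕ} {hx hy : ℝ}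
    (hhx : 0 < hx) (hhy : 0 < hy) (hJ : J * hx = b - a) (hK : K * hy = d - c) (hj : j ≤ J)
    (hk : k ≤ K) (hb : j = 0 ∨ j = J ∨ k = 0 ∨ k = K) :
    (a + j * hx, c + k * hy) ∈ frontier (rect a b c d) := by
  rw [(isOpen_rect a b c d).frontier_eq]
  refine ⟨gridPoint_mem_closure hab hcd hhx hhy hJ hK hj hk, ?_⟩
  rintro ⟨⟨h1, h2⟩, h3, h4⟩
  rcases hb with rfl | rfl | rfl | rfl <;> simp at h1 h2 h3 h4 <;> linarith

theorem gridPoint_mem_Icc {a b hx : ℝ} (hhx : 0 < hx) {J j : ℕ} (hJ : J * hx = b - a)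
    (hj : j ∈ Finset.Ioo 0 J) : a + j * hx ∈ Icc (a + hx) (b - hx) := by
  rw [Finset.mem_Ioo] at hj
  have h1 : (1 : ℝ) ≤ j := by exact_mod_cast hj.1
  have h2 : (j : ℝ) + 1 ≤ J := by exact_mod_cast hj.2
  constructor <;> nlinarith

theorem discreteLaplacian_gridRestrict (a c hx hy : ℝ) (g : ℝ × ℝ → ℂ) {j k : ℕ} (hj : 0 < j)
    (hk : 0 < k) :
    discreteLaplacian hx hy (gridRestrict a c hx hy g) j k =
      (g (a + j * hx + hx, c + k * hy) - 2 * g (a + j * hx, c + k * hy) +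
        g (a + j * hx - hx, c + k * hy)) / (hx : ℂ) ^ 2 +
      (g (a + j * hx, c + k * hy + hy) - 2 * g (a + j * hx, c + k * hy) +
        g (a + j * hx, c + k * hy - hy)) / (hy : ℂ) ^ 2 := by
  have e1 : a + ((j + 1 : ℕ) : ℝ) * hx = a + j * hx + hx := by push_cast; ring
  have e2 : a + ((j - 1 : ℕ) : ℝ) * hx = a + j * hx - hx := by
    rw [Nat.cast_sub hj]; push_cast; ring
  have e3 : c + ((k + 1 : ℕ) : ℝ) * hy = c + k * hy + hy := by push_cast; ring
  have e4 : c + ((k - 1 : ℕ) : ℝ) * hy = c + k * hy - hy := by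
    rw [Nat.cast_sub hk]; push_cast; ring
  simp only [discreteLaplacian, gridRestrict, e1, e2, e3, e4]

theorem discreteLaplacian_sub (hx hy : ℝ) (v w : ℕ → ℕ → ℂ) (j k : ℕ) :
    discreteLaplacian hx hy (fun j k => v j k - w j k) j k =
      discreteLaplacian hx hy v j k - discreteLaplacian hx hy w j k := by
  simp only [discreteLaplacian]; ring

/-- Joins consistency and stability. Only the exact solution has to be bounded by `M`; no a priori
bound on `U` enters. The value `A = 4 * M` comes from `3 * τ + 2 * hx ^ 2 + 2 * hy ^ 2 ≤ 4 * (τ + h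
^ 2)`. -/
theorem err_sq_le {a b c d T lam M hx hy h τ : ℝ} {J K N : ℕ} (hab : a < b) (hcd : c < d)
    (hT : 0 < T) {u₀ : ℝ × ℝ → ℂ} {u : ℝ → ℝ × ℝ → ℂ}
    (hu : IsSolution (rect a b c d) T lam u₀ u)
    (hu20 : InCWWithBound (rect a b c d) T 2 0 M u)
    (hu12 : InCWWithBound (rect a b c d) T 1 2 M u)
    (hu04 : InCWWithBound (rect a b c d) T 0 4 M u)
    (hJ : 0 < J) (hK : 0 < K) (hN : 0 < N) (hhx : hx = (b - a) / J) (hhy : hy = (d - c) / K)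
    (hh : h = max hx hy) (hτ : τ = T / N) (hτ1 : τ ≤ 1) (hx3 : 3 * h ≤ b - a) (hy3 : 3 * h ≤ d - c)
    {U : ℕ → ℕ → ℕ → ℂ} (hU : IsBDF1 a c hx hy τ J K N lam u₀ U)
    {C₁ B D E₀ E₁ : ℝ} (hC₁ : C₁ = 10 + 2 * (1 + M) ^ 2)
    (hB : B = 4 * |lam| + 1 + 16 * lam ^ 2 * C₁)
    (hD : D = 8 * lam ^ 2 * C₁ * ((b - a) * (d - c)) + 3 * ((b - a) * (d - c)) * (4 * M) ^ 2)
    (hE₀ : E₀ = Real.exp (B * T) * T * D)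
    (hE₁ : E₁ = 3 / 2 * E₀ + 4 * lam ^ 2 * C₁ * (2 * E₀ + (b - a) * (d - c)) +
      (b - a) * (d - c) * (4 * M) ^ 2)
    (hsmall : 2 * (E₁ * (τ + h ^ 2) ^ 2) ≤ 1) :
    ∀ n ≤ N, sqL2 hx hy J K (err a c hx hy τ u U n) ≤ E₀ * (τ + h ^ 2) ^ 2 ∧
      τ * sqH1 hx hy J K (err a c hx hy τ u U n) ≤ E₁ * (τ + h ^ 2) ^ 2 := by
  have hJ' : (0 : ℝ) < J := by exact_mod_cast hJ
  have hK' : (0 : ℝ) < K := by exact_mod_cast hK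
  have hN' : (0 : ℝ) < N := by exact_mod_cast hN
  have hx0 : 0 < hx := by rw [hhx]; exact div_pos (sub_pos.2 hab) hJ'
  have hy0 : 0 < hy := by rw [hhy]; exact div_pos (sub_pos.2 hcd) hK'
  have hτ0 : 0 < τ := by rw [hτ]; positivity
  have hJx : J * hx = b - a := by rw [hhx]; field_simp
  have hKy : K * hy = d - c := by rw [hhy]; field_simp
  have hNτ : N * τ = T := by rw [hτ]; field_simp
  have hxh : hx ≤ h := hh ▸ le_max_left _ _
  have hyh : hy ≤ h := hh ▸ le_max_right _ _
  have htime {n : ℕ} (hn : n ≤ N) : (n : ℝ) * τ ∈ Icc 0 T := by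
    refine ⟨by positivity, ?_⟩
    rw [← hNτ]
    gcongr
  have hM : 0 ≤ M := by
    obtain ⟨V, -, -, hV⟩ := hu04
    exact (norm_nonneg _).trans (hV 0 le_rfl 0 ⟨le_rfl, hT.le⟩)
  have hubound {n j k : ℕ} (hn : n ≤ N) (hj : j ≤ J) (hk : k ≤ K) :
      ‖gridRestrict a c hx hy (u (n * τ)) j k‖ ≤ M := by
    obtain ⟨V, hV, -, hVb⟩ := hu04
    refine (hV.norm_le (isOpen_rect a b c d) (isCompact_closure_rect hab hcd) hu.continuousOn
      (htime hn) (gridPoint_mem_closure hab hcd hx0 hy0 hJx hKy hj hk)).trans ?_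
    simpa using hVb 0 le_rfl _ (htime hn)
  refine stability (lam := lam) (A := 4 * M) (C₁ := C₁) (T := T)
    (F := fun n j k => f (gridRestrict a c hx hy (u (n * τ)) j k) - f (U n j k))
    (R := fun n j k => Complex.I * ((gridRestrict a c hx hy (u ((n + 1 : ℕ) * τ)) j k -
      gridRestrict a c hx hy (u (n * τ)) j k) / τ) +
      discreteLaplacian hx hy (gridRestrict a c hx hy (u ((n + 1 : ℕ) * τ))) j k -
      2 * lam * f (gridRestrict a c hx hy (u (n * τ)) j k))
    hx0 hy0 hτ0 hτ1 hJ hK (by rw [← hJx, ← hKy]; ring) hNτ (by rw [hC₁]; positivity)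
    (le_add_of_nonneg_right (sq_nonneg h)) ?_ ?_ ?_ ?_ ?_ ?_ hB hD hE₀ hE₁ hsmall
  · intro n hn j hj k hk hb
    rw [err, hU.boundary n hn j hj k hk hb, gridRestrict,
      hu.boundary _ (htime hn) _ (gridPoint_mem_frontier hab hcd hx0 hy0 hJx hKy hj hk hb), sub_zero]
  · intro j hj k hk
    rw [err, hU.initial j hj k hk, Nat.cast_zero, zero_mul, gridRestrict, gridRestrict,
      hu.initial _ (gridPoint_mem_closure hab hcd hx0 hy0 hJx hKy hj hk), sub_self]
  · intro n hn j hj k hk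
    have h1 := hU.step n hn j hj k hk
    have h2 : discreteLaplacian hx hy (err a c hx hy τ u U (n + 1)) j k = _ - _ :=
      discreteLaplacian_sub hx hy (gridRestrict a c hx hy (u ((n + 1 : ℕ) * τ))) (U (n + 1)) j k
    rw [h2]
    simp only [err]
    linear_combination -h1
  · intro n hn j hj k hk
    exact abs_im_f_sub_mul_conj_le _ _
  · intro n hn j hj k hk
    rw [hC₁]
    rw [Finset.mem_Ioo] at hj hk
    exact norm_f_sub_sq_mul_le hτ0 hτ1 (hubound hn.le hj.2.le hk.2.le)
  · intro n hn j hj k hk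
    have hdt : ((n + 1 : ℕ) : ℝ) * τ - n * τ = τ := by push_cast; ring
    have key := truncation_error_le hab hcd hT hu hu20 hu12 hu04 hx0 hy0 (by linarith)
      (by linarith) (htime hn.le) (htime (Nat.succ_le_of_lt hn)) (by linarith)
      (gridPoint_mem_Icc hx0 hJx hj) (gridPoint_mem_Icc hy0 hKy hk)
    rw [Finset.mem_Ioo] at hj hk
    rw [hdt, ← discreteLaplacian_gridRestrict _ _ _ _ _ hj.1 hk.1] at key
    refine key.trans ?_
    calc M * (3 * τ + 2 * hx ^ 2 + 2 * hy ^ 2) ≤ M * (4 * τ + 2 * h ^ 2 + 2 * h ^ 2) := by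
          gcongr
          norm_num
      _ = 4 * M * (τ + h ^ 2) := by ring

end LogSE

end

/-! ### Choice of the constants and the final estimate -/

theorem theorem3p1 (M absLam area T : ℝ) (hT : 0 < T) :
    ∃ C : ℝ, 0 < C ∧
      ∀ (a b c d : ℝ), a < b → c < d → (b - a) * (d - c) = area →
      ∀ lam : ℝ, lam ≠ 0 → |lam| = absLam →
      ∀ (u₀ : ℝ × ℝ → ℂ) (u : ℝ → ℝ × ℝ → ℂ),
        LogSE.IsSolution (LogSE.rect a b c d) T lam u₀ u →
        LogSE.InCWWithBound (LogSE.rect a b c d) T 2 0 M u →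
        LogSE.InCWWithBound (LogSE.rect a b c d) T 1 2 M u →
        LogSE.InCWWithBound (LogSE.rect a b c d) T 0 4 M u →
      ∀ κ : ℝ, ∃ h₀ > 0, ∃ τ₀ > 0,
        ∀ J K N : ℕ, 0 < J → 0 < K → 0 < N →
        ∀ hx hy h τ : ℝ, hx = (b - a) / J → hy = (d - c) / K → h = max hx hy → τ = T / N →
          h ≤ κ * min hx hy → h ≤ h₀ → τ ≤ τ₀ →
        ∀ U : ℕ → ℕ → ℕ → ℂ, LogSE.IsBDF1 a c hx hy τ J K N lam u₀ U →
        ∀ n ≤ N,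
          LogSE.normL2 hx hy J K (LogSE.err a c hx hy τ u U n) ≤ C * (τ + h ^ 2) ∧
          LogSE.seminormH1 hx hy J K (LogSE.err a c hx hy τ u U n) ≤
            C * τ ^ (-(1 / 2) : ℝ) * (τ + h ^ 2) := by
  obtain ⟨C₁, hC₁⟩ : ∃ C₁ : ℝ, C₁ = 10 + 2 * (1 + M) ^ 2 := ⟨_, rfl⟩
  obtain ⟨B, hB⟩ : ∃ B : ℝ, B = 4 * absLam + 1 + 16 * absLam ^ 2 * C₁ := ⟨_, rfl⟩
  obtain ⟨D, hD⟩ : ∃ D : ℝ, D = 8 * absLam ^ 2 * C₁ * area + 3 * area * (4 * M) ^ 2 := ⟨_, rfl⟩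
  obtain ⟨E₀, hE₀⟩ : ∃ E₀ : ℝ, E₀ = Real.exp (B * T) * T * D := ⟨_, rfl⟩
  obtain ⟨E₁, hE₁⟩ : ∃ E₁ : ℝ, E₁ = 3 / 2 * E₀ + 4 * absLam ^ 2 * C₁ * (2 * E₀ + area) +
    area * (4 * M) ^ 2 := ⟨_, rfl⟩
  -- The summand 1 ensures positivity: at this point nothing is known about the signs of `E₀` and
  -- `E₁`, and the square root of a negative number is 0.
  refine ⟨√E₀ + √E₁ + 1, by positivity, ?_⟩
  intro a b c d hab hcd harea lam _ habs u₀ u hu hu20 hu12 hu04 κ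
  -- With `τ ≤ η / 2`, `h ≤ 1` and `h ≤ η / 2` one gets `τ + h ^ 2 ≤ η ≤ 1`, and this `η` is what
  -- makes `2 * E₁ * (τ + h ^ 2) ^ 2 ≤ 1`. The side lengths enter the threshold for `h` but not the
  -- constant.
  have hη : 0 < 1 / (2 * (1 + |E₁|)) := by positivity
  generalize hηd : 1 / (2 * (1 + |E₁|)) = η at hη
  have hba : 0 < b - a := sub_pos.2 hab
  have hdc : 0 < d - c := sub_pos.2 hcd
  refine ⟨min (min ((b - a) / 3) ((d - c) / 3)) (min 1 (η / 2)), by positivity, min 1 (η / 2),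
    by positivity, ?_⟩
  intro J K N hJ hK hN hx hy h τ hhx hhy hh hτ _ hh₀ hτ₀ U hU n hn
  obtain ⟨hh1, hh2⟩ := le_min_iff.1 hh₀
  obtain ⟨hh3, hh4⟩ := le_min_iff.1 hh1
  obtain ⟨hh5, hh6⟩ := le_min_iff.1 hh2
  obtain ⟨hτ1, hτ2⟩ := le_min_iff.1 hτ₀
  have hτ0 : 0 < τ := by rw [hτ]; positivity
  have hhx0 : 0 < hx := by rw [hhx]; positivity
  have hhy0 : 0 < hy := by rw [hhy]; positivity
  have hh0 : 0 < h := hhx0.trans_le (hh ▸ le_max_left _ _)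
  have hδ0 : 0 ≤ τ + h ^ 2 := by positivity
  have hδη : τ + h ^ 2 ≤ η := by nlinarith
  have hη1 : η * (2 * (1 + |E₁|)) = 1 := by rw [← hηd]; field_simp
  have hη2 : η ≤ 1 := by nlinarith [mul_nonneg hη.le (abs_nonneg E₁)]
  have hsmall : 2 * (E₁ * (τ + h ^ 2) ^ 2) ≤ 1 := by
    calc 2 * (E₁ * (τ + h ^ 2) ^ 2) ≤ 2 * ((1 + |E₁|) * (η * 1)) := by
          have h1 : E₁ ≤ 1 + |E₁| := by linarith [le_abs_self E₁]
          have h2 : (τ + h ^ 2) ^ 2 ≤ η * 1 := by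
            rw [sq]; exact mul_le_mul hδη (hδη.trans hη2) hδ0 hη.le
          have h3 : 0 ≤ (τ + h ^ 2) ^ 2 := sq_nonneg _
          gcongr
      _ = η * (2 * (1 + |E₁|)) := by ring
      _ ≤ 1 := hη1.le
  have hsq : absLam ^ 2 = lam ^ 2 := by rw [← habs, sq_abs]
  rw [hsq] at hB hD hE₁
  rw [← habs] at hB
  rw [← harea] at hD hE₁
  obtain ⟨r0, r1⟩ := LogSE.err_sq_le hab hcd hT hu hu20 hu12 hu04 hJ hK hN hhx hhy hh hτ hτ1
    (by linarith) (by linarith) hU hC₁ hB hD hE₀ hE₁ hsmall n hn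
  have s0 := Real.sqrt_nonneg E₀
  have s1 := Real.sqrt_nonneg E₁
  constructor
  · calc LogSE.normL2 hx hy J K (LogSE.err a c hx hy τ u U n) ≤ √(E₀ * (τ + h ^ 2) ^ 2) :=
          Real.sqrt_le_sqrt r0
      _ = √E₀ * (τ + h ^ 2) := by rw [Real.sqrt_mul' _ (sq_nonneg _), Real.sqrt_sq hδ0]
      _ ≤ (√E₀ + √E₁ + 1) * (τ + h ^ 2) := by gcongr; linarith
  · have e : τ ^ (-(1 / 2) : ℝ) = (√τ)⁻¹ := by rw [Real.rpow_neg hτ0.le, Real.sqrt_eq_rpow]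
    rw [e]
    calc LogSE.seminormH1 hx hy J K (LogSE.err a c hx hy τ u U n) ≤
          √(E₁ * (τ + h ^ 2) ^ 2 / τ) :=
          Real.sqrt_le_sqrt ((le_div_iff₀' hτ0).2 r1)
      _ = √E₁ * (√τ)⁻¹ * (τ + h ^ 2) := by
        rw [Real.sqrt_div' _ hτ0.le, Real.sqrt_mul' _ (sq_nonneg _), Real.sqrt_sq hδ0]
        ring
      _ ≤ (√E₀ + √E₁ + 1) * (√τ)⁻¹ * (τ + h ^ 2) := by gcongr; linarith
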